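/- For $\mathbf x=(x,y)\in\mathbb R^2\setminus\{0\}$ put $\mathbf x^{-\perp}=(-y,x)/(x^2+y^2)$. For $\alpha\in\mathbb R$ consider on $\mathbb R^4\ni(\mathbf x_1,\mathbf x_2)$ the magnetic momenta $$D_1=-i\nabla_{\mathbf x_1}+\alpha(\mathbf x_1-\mathbf x_2)^{-\perp},\qquad D_2=-i\nabla_{\mathbf x_2}+\alpha(\mathbf x_2-\mathbf x_1)^{-\perp},$$ and let $\mathscr D_\alpha^2\subset L^2_{\mathrm{sym}}(\mathbb R^4)$ be the domain of the closure in $L^2$ of $(D_1,D_2)$, initially defined on the smooth complex-valued functions that are symmetric under $\mathbf x_1\leftrightarrow\mathbf x_2$ and compactly supported in $\mathbb R^4\setminus\{\mathbf x_1=\mathbf x_2\}$. With $Q_0=[0,1]^2$, let $$E_2^{N}(\alpha)=\inf\Bigl\{\sum_{j=1}^2\int_{Q_0^2}|D_j\Psi|^2\ :\ \Psi\in\mathscr D_\alpha^2,\ \int_{Q_0^2}|\Psi|^2=1\Bigr\}$$ be the Neumann ground-state energy of two anyons with statistics parameter $\alpha$ on the unit square. Then $$E_2^{N}(\alpha)=4\pi\alpha\bigl(1+O(\alpha^{1/3})\bigr)\qquad\text{as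 }\alpha\to0^+.$$ -/

import Mathlib

open MeasureTheory Filter Topology Asymptotics
open scoped ContDiff

noncomputable section

namespace Anyon

/-- The plane `ℝ²`, with points `(x, y)` and Lebesgue measure. -/
abbrev Plane : Type := ℝ × ℝ

/-- The configuration space `(ℝ²)^N`, with Lebesgue measure. -/
abbrev Config (N : ℕ) : Type := Fin N → Plane

/-- The Aharonov–Bohm potential `𝐱^{-⊥} = (-y, x) / (x² + y²)`. -/
def perpInv (p : Plane) : Plane :=
  (-p.2 / (p.1 ^ 2 + p.2 ^ 2), p.1 / (p.1 ^ 2 + p.2 ^ 2))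

/-- The magnetic potential `𝐀_j(𝐱₁, …, 𝐱_N) = ∑_{k ≠ j} (𝐱_j - 𝐱_k)^{-⊥}` seen by particle `j`. -/
def vecPot {N : ℕ} (j : Fin N) (x : Config N) : Plane :=
  ∑ k ∈ Finset.univ.erase j, perpInv (x j - x k)

/-- The two standard unit vectors of the plane. -/
def unitVec (c : Fin 2) : Plane := ![(1, 0), (0, 1)] c

/-- The two components of a vector in the plane. -/
def component (c : Fin 2) (p : Plane) : ℝ := ![p.1, p.2] c

/-- The `c`-th component of `D_j Ψ = (-i ∇_{𝐱_j} + α 𝐀_j) Ψ`, for a smooth `Ψ`. -/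
def momentum {N : ℕ} (α : ℝ) (j : Fin N) (c : Fin 2) (Ψ : Config N → ℂ) (x : Config N) : ℂ :=
  -Complex.I * fderiv ℝ Ψ x (Pi.single j (unitVec c))
    + ((α * component c (vecPot j x) : ℝ) : ℂ) * Ψ x

/-- The set of configurations in which at least two particles coincide. -/
def diagonals (N : ℕ) : Set (Config N) :=
  {x | ∃ j k : Fin N, j ≠ k ∧ x j = x k}

/-- Permutation-symmetric, smooth functions with compact support in `ℝ^{2N}` minus the diagonals. -/
structure IsCore {N : ℕ} (φ : Config N → ℂ) : Prop where
  smooth : ContDiff ℝ ∞ φ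
  compact : HasCompactSupport φ
  off_diagonal : Disjoint (tsupport φ) (diagonals N)
  symmetric : ∀ (σ : Equiv.Perm (Fin N)) (x : Config N), φ (x ∘ σ) = φ x

/-- `(Ψ, Φ)` lies in the graph of the operator `𝖣_α = (D_j)_j` on `L²_sym(ℝ^{2N})`, i.e. in the
`L²`-closure of the graph of `𝖣_α` on symmetric test functions supported away from the diagonals.
So `Ψ` is in the form domain and `Φ j c` is (almost everywhere) the `c`-th component of `D_j Ψ`. -/
structure InGraph {N : ℕ} (α : ℝ) (Ψ : Config N → ℂ) (Φ : Fin N → Fin 2 → Config N → ℂ) :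
    Prop where
  memLp : MemLp Ψ 2 volume
  memLp_momentum : ∀ j c, MemLp (Φ j c) 2 volume
  approx : ∃ φ : ℕ → Config N → ℂ, (∀ n, IsCore (φ n)) ∧
    Tendsto (fun n => eLpNorm (φ n - Ψ) 2 volume) atTop (𝓝 0) ∧
    ∀ j c, Tendsto (fun n => eLpNorm (momentum α j c (φ n) - Φ j c) 2 volume) atTop (𝓝 0)

/-- The product domain `Ω^N` in configuration space. -/
def power (N : ℕ) (Ω : Set Plane) : Set (Config N) := Set.univ.pi fun _ => Ω

/-- The Neumann ground-state energy `E_N^N(α; Ω)`: the infimum of `∑_j ∫_{Ω^N} |D_j Ψ|²` over all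
`Ψ` in the domain of `𝖣_α` with `∫_{Ω^N} |Ψ|² = 1`. -/
def neumannEnergyOn (N : ℕ) (α : ℝ) (Ω : Set Plane) : ℝ :=
  sInf {e : ℝ | ∃ (Ψ : Config N → ℂ) (Φ : Fin N → Fin 2 → Config N → ℂ),
    InGraph α Ψ Φ ∧ ∫ x in power N Ω, ‖Ψ x‖ ^ 2 = 1 ∧
    e = ∑ j, ∫ x in power N Ω, ∑ c, ‖Φ j c x‖ ^ 2}

/-- The unit square `Q₀ = [0,1]²`. -/
def unitSquare : Set Plane := Set.Icc 0 1 ×ˢ Set.Icc 0 1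

/-- The Neumann ground-state energy `E_N^N(α)` of `N` anyons on the unit square. -/
def neumannEnergy (N : ℕ) (α : ℝ) : ℝ := neumannEnergyOn N α unitSquare

end Anyon

end

/-! By symmetry the energy is twice that of one particle in the Aharonov–Bohm field of
the other.

For the upper bound, the trial function `|𝐱₁ - 𝐱₂| ^ α`, cut off near the diagonal, has energy
density `2 α² |𝐱₁ - 𝐱₂| ^ (2α - 2)` per particle. Over the disc of radius `R` this integrates
to `2 π α R ^ (2α)`, so that the total energy is asymptotic to `4 π α`.

For the lower bound, fix the particle at `𝐛`. On each circle about `𝐛` of radius `r`, the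
angular part of the magnetic energy is at least `α² / r²`. Completing the square in the radial
direction spreads this singular weight over the disc of radius `R`, as the constant `2 α / R²`,
whose average over the position of `𝐛` in the unit square gives `2 π α`. A diamagnetic Poincaré
inequality compares the mass on the disc with the mass on the square, at a relative cost of
order `δ + α / (δ R) + R`. The choice `δ = R = α ^ (1/3)` balances the three terms. -/

namespace Anyon

open Set
open Complex (I)
open scoped Real

/-! ### Inequalities on an interval -/

lemma sq_intervalIntegral_le {g : ℝ → ℝ} (hg : Continuous g) {a b : ℝ} (hab : a ≤ b) :
    (∫ s in a..b, g s) ^ 2 ≤ (b - a) * ∫ s in a..b, g s ^ 2 := by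
  rcases hab.eq_or_lt with rfl | hlt
  · simp
  have hne : b - a ≠ 0 := (sub_pos.2 hlt).ne'
  have hjensen := (even_two.convexOn_pow (𝕜 := ℝ)).map_set_average_le (μ := volume) (t := Ioc a b)
    (f := g) (by fun_prop) isClosed_univ (by simp [hlt]) (by simp) (by simp)
    hg.integrableOn_Ioc (hg.pow 2).integrableOn_Ioc
  simp only [setAverage_eq, Real.volume_real_Ioc_of_le hab, smul_eq_mul,
    ← intervalIntegral.integral_of_le hab] at hjensen
  calc (∫ s in a..b, g s) ^ 2 = (b - a) ^ 2 * ((b - a)⁻¹ * ∫ s in a..b, g s) ^ 2 := by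
        rw [← mul_pow, mul_inv_cancel_left₀ hne]
    _ ≤ (b - a) ^ 2 * ((b - a)⁻¹ * ∫ s in a..b, g s ^ 2) := by gcongr
    _ = (b - a) * ∫ s in a..b, g s ^ 2 := by
        rw [sq, mul_assoc, mul_inv_cancel_left₀ hne]

/-- At each point `s` the gauge factor with the constant potential `A s` turns `-i F' + A F` into an
ordinary derivative, so that no regularity of `A` is needed. -/
lemma norm_sub_norm_le_integral {F F' : ℝ → ℂ} {A : ℝ → ℝ} (hF : ∀ s, HasDerivAt F (F' s) s)
    (hD : Continuous fun s => -I * F' s + A s * F s) {a b : ℝ} (hab : a ≤ b) :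
    ‖F b‖ - ‖F a‖ ≤ ∫ s in a..b, ‖-I * F' s + A s * F s‖ := by
  set D : ℝ → ℂ := fun s => -I * F' s + A s * F s
  have hgauge (x : ℝ) :
      HasDerivAt (fun t => Complex.exp ((A x * (t - x) : ℝ) * I) * F t) (I * D x) x := by
    have hphase : HasDerivAt (fun t : ℝ => ((A x * (t - x) : ℝ) : ℂ) * I) (A x * I) x := by
      simpa using (((hasDerivAt_id x).sub_const x).const_mul (A x)).ofReal_comp.mul_const I
    refine (hphase.cexp.mul (hF x)).congr_deriv ?_
    simp only [D, sub_self, mul_zero, Complex.ofReal_zero, zero_mul, Complex.exp_zero]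
    linear_combination F' x * Complex.I_sq
  have hmain := image_le_of_liminf_slope_right_le_deriv_boundary (f := fun s => ‖F s‖)
    (B := fun s => ‖F a‖ + ∫ t in a..s, ‖D t‖) (B' := fun s => ‖D s‖) (a := a) (b := b)
    (continuous_iff_continuousAt.2 fun s => (hF s).continuousAt.norm).continuousOn (by simp)
    (continuous_const.add (intervalIntegral.continuous_primitive
      (fun _ _ => hD.norm.intervalIntegrable _ _) a)).continuousOn
    (fun s _ => ((hD.norm.integral_hasStrictDerivAt a s).hasDerivAt.const_add _).hasDerivWithinAt)
    (fun x _ r hr => ?_)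
  · linarith [hmain (right_mem_Icc.2 hab)]
  · refine ((hgauge x).hasDerivWithinAt.liminf_right_slope_norm_le
      (by simpa using hr)).mono fun z hz => ?_
    simpa only [slope_def_field, norm_mul, Complex.norm_exp_ofReal_mul_I, one_mul,
      div_eq_inv_mul] using hz

lemma abs_norm_sub_norm_le_integral {F F' : ℝ → ℂ} {A : ℝ → ℝ}
    (hF : ∀ s, HasDerivAt F (F' s) s) (hD : Continuous fun s => -I * F' s + A s * F s) {a b : ℝ}
    (hab : a ≤ b) : |‖F b‖ - ‖F a‖| ≤ ∫ s in a..b, ‖-I * F' s + A s * F s‖ := by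
  refine abs_sub_le_iff.2 ⟨norm_sub_norm_le_integral hF hD hab, ?_⟩
  have hrefl (s : ℝ) : HasDerivAt (fun t => F (-t)) (-F' (-s)) s := by
    simpa [Function.comp_def] using (hF (-s)).scomp s (hasDerivAt_neg s)
  have hD' (s : ℝ) : -I * -F' (-s) + (-A (-s) : ℝ) * F (-s)
      = -(-I * F' (-s) + A (-s) * F (-s)) := by
    push_cast; ring
  have := norm_sub_norm_le_integral (A := fun s => -A (-s)) hrefl
    (by simpa only [hD'] using (hD.comp' continuous_neg).fun_neg) (neg_le_neg hab)
  simpa only [hD', norm_neg, neg_neg, intervalIntegral.integral_comp_neg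
    (fun s => ‖-I * F' s + A s * F s‖)] using this

lemma sq_norm_sub_norm_le_integral {F F' : ℝ → ℂ} {A : ℝ → ℝ} (hF : ∀ s, HasDerivAt F (F' s) s)
    (hD : Continuous fun s => -I * F' s + A s * F s) {a b s t : ℝ} (hs : s ∈ Icc a b)
    (ht : t ∈ Icc a b) :
    (‖F s‖ - ‖F t‖) ^ 2 ≤ (b - a) * ∫ s in a..b, ‖-I * F' s + A s * F s‖ ^ 2 := by
  wlog hts : t ≤ s generalizing s t
  · rw [← neg_sub, neg_sq]
    exact this ht hs (le_of_not_ge hts)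
  refine le_trans ?_ (sq_intervalIntegral_le hD.norm (hs.1.trans hs.2))
  rw [← sq_abs]
  gcongr
  exact (abs_norm_sub_norm_le_integral hF hD hts).trans <|
    intervalIntegral.integral_mono_interval ht.1 hts hs.2 (.of_forall fun _ => norm_nonneg _)
      (hD.norm.intervalIntegrable _ _)

/-- The integral is unchanged when `F` is replaced by `F - F a` in the second factor, and
`‖F - F a‖ ≤ ∫ ‖F'‖`. -/
lemma abs_integral_im_mul_conj_le {F F' : ℝ → ℂ} (hF : ∀ s, HasDerivAt F (F' s) s)
    (hF' : Continuous F') {a b : ℝ} (hab : a ≤ b) (hper : F a = F b) :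
    |∫ s in a..b, (F' s * starRingEnd ℂ (F s)).im| ≤ (b - a) * ∫ s in a..b, ‖F' s‖ ^ 2 := by
  have hFc : Continuous F := continuous_iff_continuousAt.2 fun s => (hF s).continuousAt
  have hftc (t : ℝ) : ∫ s in a..t, F' s = F t - F a :=
    intervalIntegral.integral_eq_sub_of_hasDerivAt (fun s _ => hF s) (hF'.intervalIntegrable _ _)
  set m := ∫ s in a..b, ‖F' s‖ with hm
  have hosc (s : ℝ) (hs : s ∈ Icc a b) : ‖F s - F a‖ ≤ m := by
    rw [← hftc]
    exact (intervalIntegral.norm_integral_le_integral_norm hs.1).trans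
      (intervalIntegral.integral_mono_interval le_rfl hs.1 hs.2 (.of_forall fun _ => norm_nonneg _)
        (hF'.norm.intervalIntegrable _ _))
  have hshift : ∫ s in a..b, F' s * starRingEnd ℂ (F s)
      = ∫ s in a..b, F' s * starRingEnd ℂ (F s - F a) := by
    have hzero : ∫ s in a..b, F' s * starRingEnd ℂ (F a) = 0 := by
      rw [intervalIntegral.integral_mul_const, hftc, hper, sub_self, zero_mul]
    rw [← sub_zero (∫ s in a..b, F' s * starRingEnd ℂ (F s)), ← hzero,
      ← intervalIntegral.integral_sub]
    · simp only [map_sub, mul_sub]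
    all_goals exact (by fun_prop : Continuous _).intervalIntegrable _ _
  calc |∫ s in a..b, (F' s * starRingEnd ℂ (F s)).im|
      = |(∫ s in a..b, F' s * starRingEnd ℂ (F s)).im| := by
        congr 1
        exact Complex.imCLM.intervalIntegral_comp_comm
          ((by fun_prop : Continuous fun s => F' s * starRingEnd ℂ (F s)).intervalIntegrable _ _)
    _ ≤ ‖∫ s in a..b, F' s * starRingEnd ℂ (F s - F a)‖ := by
        rw [hshift]; exact Complex.abs_im_le_norm _
    _ ≤ ∫ s in a..b, ‖F' s‖ * m := by
        refine intervalIntegral.norm_integral_le_of_norm_le hab (.of_forall fun s hs => ?_)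
          ((hF'.norm.mul continuous_const).intervalIntegrable _ _)
        rw [norm_mul, RCLike.norm_conj]
        exact mul_le_mul_of_nonneg_left (hosc s (Ioc_subset_Icc_self hs)) (norm_nonneg _)
    _ = m ^ 2 := by rw [intervalIntegral.integral_mul_const, ← hm, sq]
    _ ≤ (b - a) * ∫ s in a..b, ‖F' s‖ ^ 2 := sq_intervalIntegral_le hF'.norm hab

lemma sq_norm_neg_I_mul_add (α : ℝ) (z w : ℂ) :
    ‖-I * z + α * w‖ ^ 2
      = ‖z‖ ^ 2 + 2 * α * (z * starRingEnd ℂ w).im + α ^ 2 * ‖w‖ ^ 2 := by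
  simp only [Complex.sq_norm, Complex.normSq_apply, Complex.mul_re, Complex.mul_im,
    Complex.add_re, Complex.add_im, Complex.conj_re, Complex.conj_im, Complex.I_re, Complex.I_im,
    Complex.neg_re, Complex.neg_im, Complex.ofReal_re, Complex.ofReal_im]
  ring

lemma sq_mul_integral_le_of_periodic {F F' : ℝ → ℂ} (hF : ∀ s, HasDerivAt F (F' s) s)
    (hF' : Continuous F') {a b : ℝ} (hab : a ≤ b) (hper : F a = F b) {α : ℝ} (hα : 0 ≤ α)
    (hα' : 2 * α * (b - a) ≤ 1) :
    α ^ 2 * ∫ s in a..b, ‖F s‖ ^ 2 ≤ ∫ s in a..b, ‖-I * F' s + α * F s‖ ^ 2 := by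
  have hFc : Continuous F := continuous_iff_continuousAt.2 fun s => (hF s).continuousAt
  have hcross := (abs_le.1 (abs_integral_im_mul_conj_le hF hF' hab hper)).1
  have hkin : 0 ≤ ∫ s in a..b, ‖F' s‖ ^ 2 :=
    intervalIntegral.integral_nonneg hab fun _ _ => sq_nonneg _
  have hexpand : ∫ s in a..b, ‖-I * F' s + α * F s‖ ^ 2 = (∫ s in a..b, ‖F' s‖ ^ 2)
      + 2 * α * (∫ s in a..b, (F' s * starRingEnd ℂ (F s)).im)
      + α ^ 2 * ∫ s in a..b, ‖F s‖ ^ 2 := by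
    simp_rw [sq_norm_neg_I_mul_add]
    rw [intervalIntegral.integral_add, intervalIntegral.integral_add,
      intervalIntegral.integral_const_mul, intervalIntegral.integral_const_mul]
    all_goals exact (by fun_prop : Continuous _).intervalIntegrable _ _
  rw [hexpand]
  nlinarith [mul_le_mul_of_nonneg_left hcross hα, mul_le_mul_of_nonneg_right hα' hkin]

/-- The quotient extends continuously by `0`, its value at `0` under the convention `x / 0 = 0`. -/
lemma continuous_sq_norm_div {F : ℝ → ℂ} (hF : Differentiable ℝ F) (h0 : F 0 = 0) :
    Continuous fun s => ‖F s‖ ^ 2 / s := by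
  have hslope : Continuous (dslope F 0) :=
    continuousOn_univ.1 ((continuousOn_dslope univ_mem).2 ⟨hF.continuous.continuousOn, hF 0⟩)
  refine (continuous_id.fun_mul (hslope.norm.fun_pow 2)).congr fun s => ?_
  have hs : F s = s * dslope F 0 s := by simpa [h0] using (sub_smul_dslope F 0 s).symm
  rw [hs]
  rcases eq_or_ne s 0 with rfl | hs0
  · simp
  · simp only [id, norm_mul, Complex.norm_real, Real.norm_eq_abs, mul_pow, sq_abs]
    field_simp

lemma mul_inner_le_mul_sq_add_sq_div (z w : ℂ) (α : ℝ) {s : ℝ} (hs : 0 < s) (hα : 0 ≤ α) :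
    2 * α * inner ℝ z w ≤ s * ‖w‖ ^ 2 + α ^ 2 * (‖z‖ ^ 2 / s) := by
  have hsq : s * ‖w‖ ^ 2 + α ^ 2 * (‖z‖ ^ 2 / s) - 2 * α * (‖z‖ * ‖w‖)
      = (s * ‖w‖ - α * ‖z‖) ^ 2 / s := by
    field_simp
    ring
  have hnonneg : 0 ≤ (s * ‖w‖ - α * ‖z‖) ^ 2 / s := by positivity
  nlinarith [mul_le_mul_of_nonneg_left (real_inner_le_norm z w) hα]

/-- Complete the square against the derivative of `α (1 - s² / R²) ‖F s‖²`, whose integral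
vanishes. -/
lemma two_mul_div_sq_mul_integral_le_radial {F F' : ℝ → ℂ} (hF : ∀ s, HasDerivAt F (F' s) s)
    (hF' : Continuous F') (h0 : F 0 = 0) {α R : ℝ} (hα : 0 ≤ α) (hR : 0 < R) :
    2 * α / R ^ 2 * ∫ s in (0 : ℝ)..R, s * ‖F s‖ ^ 2
      ≤ ∫ s in (0 : ℝ)..R, (s * ‖F' s‖ ^ 2 + α ^ 2 * (‖F s‖ ^ 2 / s)) := by
  have hFc : Continuous F := continuous_iff_continuousAt.2 fun s => (hF s).continuousAt
  have hquot := continuous_sq_norm_div (fun s => (hF s).differentiableAt) h0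
  set v' : ℝ → ℝ := fun s => (-(2 * s / R ^ 2)) * (α * ‖F s‖ ^ 2)
    + (1 - s ^ 2 / R ^ 2) * (α * (2 * inner ℝ (F s) (F' s))) with hv'
  have hder (s : ℝ) : HasDerivAt (fun s => (1 - s ^ 2 / R ^ 2) * (α * ‖F s‖ ^ 2)) (v' s) s := by
    have hweight : HasDerivAt (fun s : ℝ => 1 - s ^ 2 / R ^ 2) (-(2 * s / R ^ 2)) s := by
      simpa using ((hasDerivAt_pow 2 s).div_const (R ^ 2)).const_sub 1
    exact hweight.mul ((hF s).norm_sq.const_mul α)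
  have hInt : ∫ s in (0 : ℝ)..R, v' s = 0 := by
    rw [intervalIntegral.integral_eq_sub_of_hasDerivAt (fun s _ => hder s)
      ((by fun_prop : Continuous v').intervalIntegrable _ _)]
    simp [h0, hR.ne']
  calc 2 * α / R ^ 2 * ∫ s in (0 : ℝ)..R, s * ‖F s‖ ^ 2
      = ∫ s in (0 : ℝ)..R, (2 * α / R ^ 2 * (s * ‖F s‖ ^ 2) + v' s) := by
        rw [intervalIntegral.integral_add, hInt, intervalIntegral.integral_const_mul, add_zero]
        all_goals exact (by fun_prop : Continuous _).intervalIntegrable _ _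
    _ = ∫ s in (0 : ℝ)..R, (1 - s ^ 2 / R ^ 2) * (2 * α * inner ℝ (F s) (F' s)) := by
        congr 1 with s
        simp only [hv']; ring
    _ ≤ _ := by
        refine intervalIntegral.integral_mono_on_of_le_Ioo hR.le
          ((by fun_prop : Continuous _).intervalIntegrable _ _)
          ((by fun_prop : Continuous _).intervalIntegrable _ _) fun s hs => ?_
        have hs0 : 0 < s := hs.1
        have hle : s ^ 2 / R ^ 2 ≤ 1 :=
          (div_le_one (by positivity)).2 (pow_le_pow_left₀ hs0.le hs.2.le 2)
        calc (1 - s ^ 2 / R ^ 2) * (2 * α * inner ℝ (F s) (F' s))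
            ≤ (1 - s ^ 2 / R ^ 2) * (s * ‖F' s‖ ^ 2 + α ^ 2 * (‖F s‖ ^ 2 / s)) :=
              mul_le_mul_of_nonneg_left (mul_inner_le_mul_sq_add_sq_div _ _ _ hs0 hα)
                (sub_nonneg.2 hle)
          _ ≤ _ := mul_le_of_le_one_left (by positivity)
              (sub_le_self _ (by positivity))

/-! ### Euclidean discs and polar coordinates -/

lemma setIntegral_Icc_prod_Icc {H : ℝ × ℝ → ℝ} (hH : Continuous H) {a b c d : ℝ} (hab : a ≤ b)
    (hcd : c ≤ d) :
    ∫ p in Icc a b ×ˢ Icc c d, H p = ∫ s in a..b, ∫ t in c..d, H (s, t) := by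
  rw [Measure.volume_eq_prod, setIntegral_prod _
    (hH.continuousOn.integrableOn_compact (isCompact_Icc.prod isCompact_Icc))]
  simp only [integral_Icc_eq_integral_Ioc, intervalIntegral.integral_of_le hab,
    intervalIntegral.integral_of_le hcd]

lemma integral_integral_swap_of_continuous {H : ℝ × ℝ → ℝ} (hH : Continuous H) (a b c d : ℝ) :
    ∫ s in a..b, ∫ t in c..d, H (s, t) = ∫ t in c..d, ∫ s in a..b, H (s, t) :=
  intervalIntegral_intervalIntegral_swap <| (hH.continuousOn.integrableOn_compact
    (isCompact_uIcc.prod isCompact_uIcc)).mono_set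
    (prod_mono uIoc_subset_uIcc uIoc_subset_uIcc)

/-- The squared Euclidean distance in the plane. The metric of `ℝ × ℝ` itself is the sup metric. -/
def sqDist (a b : Plane) : ℝ := (a.1 - b.1) ^ 2 + (a.2 - b.2) ^ 2

lemma sqDist_nonneg (a b : Plane) : 0 ≤ sqDist a b := by
  unfold sqDist; positivity

lemma sqDist_comm (a b : Plane) : sqDist a b = sqDist b a := by
  unfold sqDist; ring

lemma sqDist_eq_zero {a b : Plane} : sqDist a b = 0 ↔ a = b := by
  rw [sqDist, add_eq_zero_iff_of_nonneg (sq_nonneg _) (sq_nonneg _), sq_eq_zero_iff,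
    sq_eq_zero_iff, sub_eq_zero, sub_eq_zero, Prod.ext_iff]

@[fun_prop]
lemma continuous_sqDist {X : Type*} [TopologicalSpace X] {u v : X → Plane} (hu : Continuous u)
    (hv : Continuous v) : Continuous fun x => sqDist (u x) (v x) := by
  unfold sqDist; fun_prop

/-- The open Euclidean disc with centre `b` and radius `R`. -/
def disc (b : Plane) (R : ℝ) : Set Plane := {a | sqDist a b < R ^ 2}

lemma measurableSet_disc (b : Plane) (R : ℝ) : MeasurableSet (disc b R) :=
  (isOpen_lt (by fun_prop) continuous_const).measurableSet

lemma disc_subset_Icc_prod_Icc (b : Plane) {R : ℝ} (hR : 0 ≤ R) :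
    disc b R ⊆ Icc (b.1 - R) (b.1 + R) ×ˢ Icc (b.2 - R) (b.2 + R) := by
  intro a ha
  have ha' : (a.1 - b.1) ^ 2 + (a.2 - b.2) ^ 2 < R ^ 2 := ha
  have h₁ := abs_le.1 (abs_le_of_sq_le_sq (by linarith [sq_nonneg (a.2 - b.2)]) hR :
    |a.1 - b.1| ≤ R)
  have h₂ := abs_le.1 (abs_le_of_sq_le_sq (by linarith [sq_nonneg (a.1 - b.1)]) hR :
    |a.2 - b.2| ≤ R)
  exact ⟨⟨by linarith [h₁.1], by linarith [h₁.2]⟩, by linarith [h₂.1], by linarith [h₂.2]⟩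

/-- Polar coordinates `(r, θ)` centred at `b`. -/
noncomputable def polar (b : Plane) (p : ℝ × ℝ) : Plane :=
  b + (p.1 * Real.cos p.2, p.1 * Real.sin p.2)

@[fun_prop]
lemma continuous_polar (b : Plane) : Continuous (polar b) := by
  unfold polar; fun_prop

lemma sqDist_polar (b : Plane) (p : ℝ × ℝ) : sqDist (polar b p) b = p.1 ^ 2 := by
  simp only [sqDist, polar, Prod.fst_add, Prod.snd_add, add_sub_cancel_left]
  linear_combination p.1 ^ 2 * Real.sin_sq_add_cos_sq p.2

lemma indicator_disc_polar (b : Plane) {R : ℝ} (hR : 0 ≤ R) (G : Plane → ℝ) (p : ℝ × ℝ) :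
    polarCoord.target.indicator
        (fun p => p.1 • (disc b R).indicator G (b + polarCoord.symm p)) p
      = (Ioo 0 R ×ˢ Ioo (-π) π).indicator (fun p => p.1 * G (polar b p)) p := by
  have hmem (hp : 0 < p.1) : polar b p ∈ disc b R ↔ p.1 < R := by
    rw [disc, mem_ofPred_eq, sqDist_polar, pow_lt_pow_iff_left₀ hp.le hR two_ne_zero]
  classical
  simp only [indicator_apply, polarCoord_target, mem_prod, mem_Ioi, mem_Ioo, polarCoord_symm_apply,
    smul_eq_mul, ← polar.eq_1]
  by_cases hp : 0 < p.1
  · simp only [hp, hmem hp, true_and, mul_ite, mul_zero]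
    grind
  · simp [hp]

lemma setIntegral_disc (b : Plane) {R : ℝ} (hR : 0 ≤ R) (G : Plane → ℝ) :
    ∫ a in disc b R, G a = ∫ p in Icc 0 R ×ˢ Icc (-π) π, p.1 * G (polar b p) := by
  calc ∫ a in disc b R, G a
      = ∫ a, (disc b R).indicator G (b + a) := by
        rw [integral_add_left_eq_self, integral_indicator (measurableSet_disc b R)]
    _ = ∫ p in Ioo 0 R ×ˢ Ioo (-π) π, p.1 * G (polar b p) := by
        rw [← integral_comp_polarCoord_symm,
          ← integral_indicator polarCoord.open_target.measurableSet,
          ← integral_indicator (measurableSet_Ioo.prod measurableSet_Ioo)]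
        exact integral_congr_ae (.of_forall (indicator_disc_polar b hR G))
    _ = _ := setIntegral_congr_set (Measure.set_prod_ae_eq Ioo_ae_eq_Icc Ioo_ae_eq_Icc)

lemma setIntegral_disc_of_continuous (b : Plane) {R : ℝ} (hR : 0 ≤ R) {G : Plane → ℝ}
    (hG : Continuous G) :
    ∫ a in disc b R, G a = ∫ r in (0 : ℝ)..R, ∫ θ in -π..π, r * G (polar b (r, θ)) := by
  rw [setIntegral_disc b hR, setIntegral_Icc_prod_Icc (by fun_prop) hR
    (neg_le_self Real.pi_pos.le)]

lemma setIntegral_disc_sqDist (b : Plane) {R : ℝ} (hR : 0 ≤ R) (g : ℝ → ℝ) :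
    ∫ a in disc b R, g (sqDist a b) = 2 * π * ∫ r in (0 : ℝ)..R, r * g (r ^ 2) := by
  have hsplit (p : ℝ × ℝ) : p.1 * g (sqDist (polar b p) b) = p.1 * g (p.1 ^ 2) * 1 := by
    rw [sqDist_polar, mul_one]
  simp_rw [setIntegral_disc b hR, hsplit]
  rw [Measure.volume_eq_prod, setIntegral_prod_mul (fun r => r * g (r ^ 2)) fun _ => (1 : ℝ),
    intervalIntegral.integral_of_le hR, integral_Icc_eq_integral_Ioc, setIntegral_const,
    Real.volume_real_Icc_of_le (neg_le_self Real.pi_pos.le), smul_eq_mul]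
  ring

lemma volume_real_disc (b : Plane) {R : ℝ} (hR : 0 ≤ R) : volume.real (disc b R) = π * R ^ 2 := by
  have h := setIntegral_disc_sqDist b hR fun _ => 1
  simp only [mul_one, integral_id, setIntegral_const, smul_eq_mul] at h
  rw [h]
  ring

/-! ### One particle in a magnetic potential -/

lemma continuous_mul_of_continuousAt_tsupport {X R : Type*} [TopologicalSpace X]
    [TopologicalSpace R] [MulZeroClass R] [ContinuousMul R] {k f : X → R} (hf : Continuous f)
    (hk : ∀ x ∈ tsupport f, ContinuousAt k x) : Continuous fun x => k x * f x :=
  continuous_of_tsupport fun x hx => (hk x (tsupport_mul_subset_right hx)).mul hf.continuousAt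

section Slices

variable {g : ℝ × ℝ → ℂ} (hg : Differentiable ℝ g)
include hg

lemma hasDerivAt_slice_fst (s t : ℝ) :
    HasDerivAt (fun s => g (s, t)) (fderiv ℝ g (s, t) (1, 0)) s :=
  (hg (s, t)).hasFDerivAt.comp_hasDerivAt s ((hasDerivAt_id s).prodMk (hasDerivAt_const s t))

lemma hasDerivAt_slice_snd (s t : ℝ) :
    HasDerivAt (fun t => g (s, t)) (fderiv ℝ g (s, t) (0, 1)) t :=
  (hg (s, t)).hasFDerivAt.comp_hasDerivAt t ((hasDerivAt_const t s).prodMk (hasDerivAt_id t))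

end Slices

/-- The `c`-th component of `(-i ∇ + 𝐀) f` for a magnetic potential `𝐀` on the plane. -/
noncomputable def magneticDeriv (A : Plane → Plane) (c : Fin 2) (f : Plane → ℂ) (a : Plane) : ℂ :=
  -I * fderiv ℝ f a (unitVec c) + component c (A a) * f a

/-- The energy density `|(-i ∇ + 𝐀) f|²`. -/
noncomputable def magneticDensity (A : Plane → Plane) (f : Plane → ℂ) (a : Plane) : ℝ :=
  ∑ c, ‖magneticDeriv A c f a‖ ^ 2

/-- The Aharonov–Bohm potential `α (𝐚 - 𝐛)^{-⊥}` of a flux `α` located at `b`. -/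
noncomputable def abPotential (α : ℝ) (b a : Plane) : Plane := α • perpInv (a - b)

lemma magneticDensity_nonneg (A : Plane → Plane) (f : Plane → ℂ) (a : Plane) :
    0 ≤ magneticDensity A f a := Finset.sum_nonneg fun _ _ => sq_nonneg _

@[fun_prop]
lemma continuous_component (c : Fin 2) : Continuous (component c) := by
  fin_cases c
  exacts [continuous_fst, continuous_snd]

lemma continuousAt_perpInv {a : Plane} (ha : a ≠ 0) : ContinuousAt perpInv a := by
  have hden : a.1 ^ 2 + a.2 ^ 2 ≠ 0 := by simpa [sqDist] using mt sqDist_eq_zero.1 ha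
  exact ContinuousAt.prodMk (by fun_prop (disch := exact hden)) (by fun_prop (disch := exact hden))

lemma continuousAt_abPotential (α : ℝ) {a b : Plane} (hab : a ≠ b) :
    ContinuousAt (abPotential α b) a :=
  ((continuousAt_perpInv (sub_ne_zero.2 hab)).comp (f := fun a => a - b)
    (by fun_prop)).const_smul α

lemma continuous_magneticDeriv {A : Plane → Plane} {f : Plane → ℂ} (hf : ContDiff ℝ 1 f)
    (hA : ∀ a ∈ tsupport f, ContinuousAt A a) (c : Fin 2) : Continuous (magneticDeriv A c f) := by
  refine Continuous.add (by fun_prop) (continuous_mul_of_continuousAt_tsupport hf.continuous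
    fun a ha => ?_)
  exact Complex.continuous_ofReal.continuousAt.comp
    ((continuous_component c).continuousAt.comp (hA a ha))

lemma continuous_magneticDeriv_abPotential {f : Plane → ℂ} {b : Plane} (hf : ContDiff ℝ 1 f)
    (hb : b ∉ tsupport f) (α : ℝ) (c : Fin 2) : Continuous (magneticDeriv (abPotential α b) c f) :=
  continuous_magneticDeriv hf
    (fun _ ha => continuousAt_abPotential α (ne_of_mem_of_not_mem ha hb)) c

lemma continuous_magneticDensity {A : Plane → Plane} {f : Plane → ℂ}
    (hD : ∀ c, Continuous (magneticDeriv A c f)) : Continuous (magneticDensity A f) := by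
  unfold magneticDensity; fun_prop

section Hardy

variable {g : ℝ × ℝ → ℂ} {α R : ℝ}

lemma continuous_div_fst {h : ℝ × ℝ → ℝ} (hh : Continuous h) (h0 : ∀ p ∈ tsupport h, p.1 ≠ 0) :
    Continuous fun p => h p / p.1 := by
  simp_rw [div_eq_inv_mul]
  exact continuous_mul_of_continuousAt_tsupport hh fun p hp => continuousAt_fst.inv₀ (h0 p hp)

lemma tsupport_sq_norm_subset {X : Type*} [TopologicalSpace X] (f : X → ℂ) :
    tsupport (fun x => ‖f x‖ ^ 2) ⊆ tsupport f :=
  tsupport_comp_subset (g := fun z : ℂ => ‖z‖ ^ 2) (by simp) f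

lemma radial_integral_le (hg : ContDiff ℝ 1 g) (h0 : ∀ p ∈ tsupport g, p.1 ≠ 0) (hα : 0 ≤ α)
    (hR : 0 < R) {a b : ℝ} (hab : a ≤ b) :
    2 * α / R ^ 2 * ∫ r in (0 : ℝ)..R, ∫ θ in a..b, r * ‖g (r, θ)‖ ^ 2
      ≤ ∫ r in (0 : ℝ)..R, ∫ θ in a..b,
          (r * ‖fderiv ℝ g (r, θ) (1, 0)‖ ^ 2 + α ^ 2 * (‖g (r, θ)‖ ^ 2 / r)) := by
  have hgc : Continuous g := hg.continuous
  have hquot : Continuous fun p : ℝ × ℝ => ‖g p‖ ^ 2 / p.1 :=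
    continuous_div_fst (by fun_prop) fun p hp => h0 p (tsupport_sq_norm_subset g hp)
  have hInt : Continuous fun p : ℝ × ℝ =>
      p.1 * ‖fderiv ℝ g p (1, 0)‖ ^ 2 + α ^ 2 * (‖g p‖ ^ 2 / p.1) := by fun_prop
  have hg0 (θ : ℝ) : g (0, θ) = 0 := image_eq_zero_of_notMem_tsupport fun h => h0 _ h rfl
  rw [integral_integral_swap_of_continuous (H := fun p => p.1 * ‖g p‖ ^ 2) (by fun_prop),
    integral_integral_swap_of_continuous hInt,
    ← intervalIntegral.integral_const_mul]
  refine intervalIntegral.integral_mono_on hab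
    (Continuous.intervalIntegrable (continuous_const.mul <|
      intervalIntegral.continuous_parametric_intervalIntegral_of_continuous'
        (f := fun θ r => r * ‖g (r, θ)‖ ^ 2) (by fun_prop) 0 R) _ _)
    (Continuous.intervalIntegrable (
      intervalIntegral.continuous_parametric_intervalIntegral_of_continuous'
        (f := fun θ r => r * ‖fderiv ℝ g (r, θ) (1, 0)‖ ^ 2 + α ^ 2 * (‖g (r, θ)‖ ^ 2 / r))
        (hInt.comp continuous_swap) 0 R) _ _)
    fun θ _ => ?_
  exact two_mul_div_sq_mul_integral_le_radial
    (fun r => hasDerivAt_slice_fst (hg.differentiable one_ne_zero) r θ) (by fun_prop) (hg0 θ) hα hR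

lemma angular_integral_le (hg : ContDiff ℝ 1 g) {a b : ℝ} (hab : a ≤ b) {r : ℝ} (hr : 0 < r)
    (hper : g (r, a) = g (r, b)) (hα : 0 ≤ α) (hα' : 2 * α * (b - a) ≤ 1) :
    ∫ θ in a..b, (r * ‖fderiv ℝ g (r, θ) (1, 0)‖ ^ 2 + α ^ 2 * (‖g (r, θ)‖ ^ 2 / r))
      ≤ ∫ θ in a..b, (r * ‖fderiv ℝ g (r, θ) (1, 0)‖ ^ 2
          + ‖-I * fderiv ℝ g (r, θ) (0, 1) + α * g (r, θ)‖ ^ 2 / r) := by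
  have hgc : Continuous g := hg.continuous
  have hcircle := sq_mul_integral_le_of_periodic
    (fun θ => hasDerivAt_slice_snd (hg.differentiable one_ne_zero) r θ) (by fun_prop) hab hper
    hα hα'
  simp_rw [div_eq_inv_mul, mul_left_comm (α ^ 2)]
  rw [intervalIntegral.integral_add, intervalIntegral.integral_add,
    intervalIntegral.integral_const_mul r⁻¹, intervalIntegral.integral_const_mul r⁻¹,
    intervalIntegral.integral_const_mul (α ^ 2)]
  · gcongr
  all_goals exact (by fun_prop : Continuous _).intervalIntegrable _ _

lemma hardy_polar (hg : ContDiff ℝ 1 g) (h0 : ∀ p ∈ tsupport g, p.1 ≠ 0) {a b : ℝ} (hab : a ≤ b)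
    (hper : ∀ r, g (r, a) = g (r, b)) (hα : 0 ≤ α) (hα' : 2 * α * (b - a) ≤ 1) (hR : 0 < R) :
    2 * α / R ^ 2 * ∫ r in (0 : ℝ)..R, ∫ θ in a..b, r * ‖g (r, θ)‖ ^ 2
      ≤ ∫ r in (0 : ℝ)..R, ∫ θ in a..b, (r * ‖fderiv ℝ g (r, θ) (1, 0)‖ ^ 2
          + ‖-I * fderiv ℝ g (r, θ) (0, 1) + α * g (r, θ)‖ ^ 2 / r) := by
  have hgc : Continuous g := hg.continuous
  have hquot : Continuous fun p : ℝ × ℝ => ‖g p‖ ^ 2 / p.1 :=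
    continuous_div_fst (by fun_prop) fun p hp => h0 p (tsupport_sq_norm_subset g hp)
  have hquot' : Continuous fun p : ℝ × ℝ => ‖-I * fderiv ℝ g p (0, 1) + α * g p‖ ^ 2 / p.1 := by
    refine continuous_div_fst (by fun_prop) fun p hp => h0 p ?_
    refine closure_minimal (fun q hq => ?_) (isClosed_tsupport g) hp
    contrapose! hq
    simp [fderiv_of_notMem_tsupport ℝ hq, image_eq_zero_of_notMem_tsupport hq]
  refine (radial_integral_le hg h0 hα hR hab).trans ?_
  refine intervalIntegral.integral_mono_on_of_le_Ioo hR.le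
    (Continuous.intervalIntegrable (
      intervalIntegral.continuous_parametric_intervalIntegral_of_continuous'
        (f := fun r θ => r * ‖fderiv ℝ g (r, θ) (1, 0)‖ ^ 2 + α ^ 2 * (‖g (r, θ)‖ ^ 2 / r))
        (by fun_prop) a b) _ _)
    (Continuous.intervalIntegrable (
      intervalIntegral.continuous_parametric_intervalIntegral_of_continuous'
        (f := fun r θ => r * ‖fderiv ℝ g (r, θ) (1, 0)‖ ^ 2
          + ‖-I * fderiv ℝ g (r, θ) (0, 1) + α * g (r, θ)‖ ^ 2 / r) (by fun_prop) a b) _ _)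
    fun r hr => ?_
  exact angular_integral_le hg hab hr.1 (hper r) hα hα'

end Hardy

lemma fderiv_plane_apply (f : Plane → ℂ) (a : Plane) (x y : ℝ) :
    fderiv ℝ f a (x, y) = x * fderiv ℝ f a (1, 0) + y * fderiv ℝ f a (0, 1) := by
  have hxy : ((x, y) : Plane) = x • ((1, 0) : Plane) + y • ((0, 1) : Plane) := by simp
  rw [hxy, map_add, map_smul, map_smul, Complex.real_smul, Complex.real_smul]

lemma fderiv_comp_polar_fst {f : Plane → ℂ} (hf : Differentiable ℝ f) (b : Plane) (r θ : ℝ) :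
    fderiv ℝ (f ∘ polar b) (r, θ) (1, 0)
      = fderiv ℝ f (polar b (r, θ)) (Real.cos θ, Real.sin θ) := by
  have hpolar : HasDerivAt (fun r => polar b (r, θ)) (Real.cos θ, Real.sin θ) r := by
    refine HasDerivAt.const_add b (HasDerivAt.prodMk ?_ ?_)
    · simpa using (hasDerivAt_id r).mul_const (Real.cos θ)
    · simpa using (hasDerivAt_id r).mul_const (Real.sin θ)
  exact (hasDerivAt_slice_fst (hf.comp (by unfold polar; fun_prop)) r θ).unique
    ((hf _).hasFDerivAt.comp_hasDerivAt r hpolar)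

lemma fderiv_comp_polar_snd {f : Plane → ℂ} (hf : Differentiable ℝ f) (b : Plane) (r θ : ℝ) :
    fderiv ℝ (f ∘ polar b) (r, θ) (0, 1)
      = fderiv ℝ f (polar b (r, θ)) (-(r * Real.sin θ), r * Real.cos θ) := by
  have hpolar : HasDerivAt (fun θ => polar b (r, θ)) (-(r * Real.sin θ), r * Real.cos θ) θ := by
    refine HasDerivAt.const_add b (HasDerivAt.prodMk ?_ ?_)
    · simpa using (Real.hasDerivAt_cos θ).const_mul r
    · simpa using (Real.hasDerivAt_sin θ).const_mul r
  exact (hasDerivAt_slice_snd (hf.comp (by unfold polar; fun_prop)) r θ).unique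
    ((hf _).hasFDerivAt.comp_hasDerivAt θ hpolar)

lemma sq_norm_rotate_add_sq_norm_rotate (z w : ℂ) (θ : ℝ) :
    ‖(Real.cos θ : ℂ) * z + Real.sin θ * w‖ ^ 2 + ‖-(Real.sin θ : ℂ) * z + Real.cos θ * w‖ ^ 2
      = ‖z‖ ^ 2 + ‖w‖ ^ 2 := by
  simp only [Complex.sq_norm, Complex.normSq_apply, Complex.mul_re, Complex.mul_im, Complex.add_re,
    Complex.add_im, Complex.neg_re, Complex.neg_im, Complex.ofReal_re, Complex.ofReal_im]
  linear_combination (z.re ^ 2 + z.im ^ 2 + w.re ^ 2 + w.im ^ 2) * Real.sin_sq_add_cos_sq θ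

lemma perpInv_polar {r : ℝ} (hr : r ≠ 0) (b : Plane) (θ : ℝ) :
    perpInv (polar b (r, θ) - b) = (-(Real.sin θ / r), Real.cos θ / r) := by
  have hden : (r * Real.cos θ) ^ 2 + (r * Real.sin θ) ^ 2 = r ^ 2 := by
    linear_combination r ^ 2 * Real.sin_sq_add_cos_sq θ
  simp only [polar, add_sub_cancel_left, perpInv, hden]
  ext <;> simp only <;> field_simp

/-- The radial and angular components of `(-i ∇ + 𝐀) f` are `-i ∂_r f` and
`r⁻¹ (-i ∂_θ + α) f`. -/
lemma magneticDensity_polar {f : Plane → ℂ} (hf : Differentiable ℝ f) (α : ℝ) (b : Plane) {r : ℝ}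
    (hr : r ≠ 0) (θ : ℝ) :
    magneticDensity (abPotential α b) f (polar b (r, θ))
      = ‖fderiv ℝ (f ∘ polar b) (r, θ) (1, 0)‖ ^ 2
        + ‖-I * fderiv ℝ (f ∘ polar b) (r, θ) (0, 1) + α * (f ∘ polar b) (r, θ)‖ ^ 2 / r ^ 2 := by
  have hsc : (Real.sin θ : ℂ) ^ 2 + (Real.cos θ : ℂ) ^ 2 = 1 := by
    exact_mod_cast Real.sin_sq_add_cos_sq θ
  have hr' : (r : ℂ) ≠ 0 := by exact_mod_cast hr
  rw [fderiv_comp_polar_fst hf, fderiv_comp_polar_snd hf, fderiv_plane_apply f _ (Real.cos θ),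
    fderiv_plane_apply f _ (-(r * Real.sin θ)), magneticDensity, Fin.sum_univ_two,
    ← sq_norm_rotate_add_sq_norm_rotate _ _ θ]
  simp only [magneticDeriv, abPotential, perpInv_polar hr, component, unitVec, Prod.smul_mk,
    smul_eq_mul, Matrix.cons_val_zero, Matrix.cons_val_one, Function.comp_apply]
  set w := f (polar b (r, θ))
  set px := fderiv ℝ f (polar b (r, θ)) (1, 0)
  set py := fderiv ℝ f (polar b (r, θ)) (0, 1)
  have hradial : ‖Real.cos θ * px + Real.sin θ * py‖
      = ‖-I * (Real.cos θ * px + Real.sin θ * py)‖ := by simp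
  have hdiv (z : ℂ) : ‖z‖ ^ 2 / r ^ 2 = ‖z / (r : ℂ)‖ ^ 2 := by
    rw [norm_div, Complex.norm_real, Real.norm_eq_abs, div_pow, sq_abs]
  rw [hradial, hdiv]
  congr 3
  · push_cast
    ring
  · push_cast
    field_simp
    push_cast at hsc
    linear_combination α * w * hsc

theorem hardy_disc {f : Plane → ℂ} (hf : ContDiff ℝ 1 f) {b : Plane} (hb : b ∉ tsupport f)
    {α R : ℝ} (hα : 0 ≤ α) (hα' : 4 * π * α ≤ 1) (hR : 0 < R) :
    2 * α / R ^ 2 * ∫ a in disc b R, ‖f a‖ ^ 2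
      ≤ ∫ a in disc b R, magneticDensity (abPotential α b) f a := by
  have hfc : Continuous f := hf.continuous
  have hdens : Continuous (magneticDensity (abPotential α b) f) :=
    continuous_magneticDensity (continuous_magneticDeriv_abPotential hf hb α)
  have hsupp : ∀ p ∈ tsupport (f ∘ polar b), p.1 ≠ 0 := fun p hp hp0 => by
    have hp' : polar b p ∈ tsupport f := tsupport_comp_subset_preimage f (continuous_polar b) hp
    exact hb (by simpa [polar, hp0, ← Prod.zero_eq_mk] using hp')
  have hpolar := hardy_polar (g := f ∘ polar b) (hf.comp (by unfold polar; fun_prop)) hsupp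
    (neg_le_self Real.pi_pos.le) (fun r => by simp [polar]) hα (by linarith) hR
  rw [setIntegral_disc_of_continuous b hR.le hdens,
    setIntegral_disc_of_continuous b hR.le (by fun_prop)]
  refine hpolar.trans_eq ?_
  refine intervalIntegral.integral_congr_uIoo fun r hr => ?_
  have hr0 : r ≠ 0 := by
    rw [uIoo_of_le hR.le] at hr
    exact hr.1.ne'
  refine intervalIntegral.integral_congr fun θ _ => ?_
  simp only [magneticDensity_polar (hf.differentiable one_ne_zero) α b hr0 θ]
  field_simp

/-! ### Means over the unit square -/

lemma isCompact_unitSquare : IsCompact unitSquare := isCompact_Icc.prod isCompact_Icc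

lemma measurableSet_unitSquare : MeasurableSet unitSquare := isCompact_unitSquare.measurableSet

lemma volume_real_unitSquare : volume.real unitSquare = 1 := by
  rw [unitSquare, Measure.volume_eq_prod, measureReal_prod_prod]
  simp

lemma setIntegral_unitSquare {H : Plane → ℝ} (hH : Continuous H) :
    ∫ p in unitSquare, H p = ∫ s in (0 : ℝ)..1, ∫ t in (0 : ℝ)..1, H (s, t) :=
  setIntegral_Icc_prod_Icc hH zero_le_one zero_le_one

lemma sq_le_one_add_mul_sq_add (a b : ℝ) {δ : ℝ} (hδ : 0 < δ) :
    a ^ 2 ≤ (1 + δ) * b ^ 2 + (1 + δ⁻¹) * (b - a) ^ 2 := by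
  have hsq : (1 + δ) * b ^ 2 + (1 + δ⁻¹) * (b - a) ^ 2 - a ^ 2 = δ⁻¹ * (δ * b + (b - a)) ^ 2 := by
    field_simp
    ring
  have hnonneg : 0 ≤ δ⁻¹ * (δ * b + (b - a)) ^ 2 := by positivity
  linarith

lemma measureReal_mul_setIntegral_le {X : Type*} [MeasurableSpace X] {μ : Measure X} {S T : Set X}
    (hS : MeasurableSet S) (hT : MeasurableSet T) (hμS : μ S ≠ ⊤) (hμT : μ T ≠ ⊤) {f g : X → ℝ}
    (hf : IntegrableOn f S μ) (hg : IntegrableOn g T μ) (hfg : ∀ q ∈ S, ∀ p ∈ T, f q ≤ g p) :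
    μ.real T * ∫ q in S, f q ∂μ ≤ μ.real S * ∫ p in T, g p ∂μ := by
  have hinner (q : X) (hq : q ∈ S) : μ.real T * f q ≤ ∫ p in T, g p ∂μ := by
    simpa using setIntegral_mono_on (integrableOn_const hμT) hg hT (hfg q hq)
  simpa only [integral_const_mul, setIntegral_const, smul_eq_mul] using
    setIntegral_mono_on (hf.const_mul (μ.real T)) (integrableOn_const hμS) hS hinner

section Mean

variable {T : Set Plane} {l m δ : ℝ}

lemma setIntegral_comp_snd_le {g : ℝ → ℝ} (hg : Continuous g) (hg0 : ∀ y, 0 ≤ g y) (hlm : l ≤ m)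
    (hT : T ⊆ Icc l m ×ˢ Icc 0 1) :
    ∫ p in T, g p.2 ≤ (m - l) * ∫ y in (0 : ℝ)..1, g y := by
  have hgc : Continuous fun p : Plane => g p.2 := by fun_prop
  refine (setIntegral_mono_set (hgc.continuousOn.integrableOn_compact
    (isCompact_Icc.prod isCompact_Icc)) (.of_forall fun p => hg0 _) hT.eventuallyLE).trans_eq ?_
  rw [setIntegral_Icc_prod_Icc hgc hlm zero_le_one]
  simp only [intervalIntegral.integral_const, smul_eq_mul]

/-- Move from `q` to `p` along a vertical and then a horizontal segment. -/
lemma mean_sq_unitSquare_le {u : Plane → ℝ} (hu : Continuous u) {gx gy : ℝ → ℝ}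
    (hgx : Continuous gx) (hgy : Continuous gy)
    (hx : ∀ y, ∀ s ∈ Icc (0 : ℝ) 1, ∀ t ∈ Icc (0 : ℝ) 1, (u (s, y) - u (t, y)) ^ 2 ≤ gx y)
    (hy : ∀ x, ∀ s ∈ Icc (0 : ℝ) 1, ∀ t ∈ Icc (0 : ℝ) 1, (u (x, s) - u (x, t)) ^ 2 ≤ gy x)
    (hT : MeasurableSet T) (hlm : l ≤ m) (hTQ : T ⊆ unitSquare) (hTlm : T ⊆ Icc l m ×ˢ Icc 0 1)
    (hδ : 0 < δ) :
    volume.real T * ∫ q in unitSquare, u q ^ 2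
      ≤ (1 + δ) * (∫ p in T, u p ^ 2) + 2 * (1 + δ⁻¹)
        * ((m - l) * (∫ y in (0 : ℝ)..1, gx y) + volume.real T * ∫ x in (0 : ℝ)..1, gy x) := by
  have hQ {h : Plane → ℝ} (hh : Continuous h) : IntegrableOn h unitSquare :=
    hh.continuousOn.integrableOn_compact isCompact_unitSquare
  have hgx0 (y : ℝ) : 0 ≤ gx y := (sq_nonneg _).trans (hx y 0 (by simp) 0 (by simp))
  have hpt : ∀ q ∈ unitSquare, ∀ p ∈ T, u q ^ 2 - 2 * (1 + δ⁻¹) * gy q.1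
      ≤ (1 + δ) * u p ^ 2 + 2 * (1 + δ⁻¹) * gx p.2 := fun q hq p hp => by
    have hhor : (u p - u (q.1, p.2)) ^ 2 ≤ gx p.2 := hx p.2 _ (hTQ hp).1 _ hq.1
    have hver : (u (q.1, p.2) - u q) ^ 2 ≤ gy q.1 := hy q.1 _ (hTQ hp).2 _ hq.2
    have hosc : (u p - u q) ^ 2 ≤ 2 * (gx p.2 + gy q.1) := by
      nlinarith [sq_nonneg ((u p - u (q.1, p.2)) - (u (q.1, p.2) - u q))]
    have hδ' : 0 ≤ 1 + δ⁻¹ := by positivity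
    linarith [sq_le_one_add_mul_sq_add (u q) (u p) hδ, mul_le_mul_of_nonneg_left hosc hδ']
  have hmean := measureReal_mul_setIntegral_le measurableSet_unitSquare hT
    isCompact_unitSquare.measure_ne_top
    (isCompact_unitSquare.measure_lt_top.trans_le' (measure_mono hTQ)).ne
    (hQ (by fun_prop)) ((hQ (by fun_prop)).mono_set hTQ) hpt
  rw [volume_real_unitSquare, one_mul, integral_sub (hQ (by fun_prop)) (hQ (by fun_prop)),
    integral_add ((hQ (by fun_prop)).mono_set hTQ) ((hQ (by fun_prop)).mono_set hTQ),
    integral_const_mul, integral_const_mul, integral_const_mul,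
    setIntegral_unitSquare (H := fun q => gy q.1) (by fun_prop)] at hmean
  simp only [intervalIntegral.integral_const, sub_zero, one_smul] at hmean
  have hstrip : 2 * (1 + δ⁻¹) * ∫ p in T, gx p.2
      ≤ 2 * (1 + δ⁻¹) * ((m - l) * ∫ y in (0 : ℝ)..1, gx y) := by
    gcongr
    exact setIntegral_comp_snd_le hgx hgx0 hlm hTlm
  linarith

end Mean

section OneParticle

variable {f : Plane → ℂ} {b : Plane} {α R δ : ℝ}

lemma setIntegral_unitSquare_magneticDensity {A : Plane → Plane}
    (hD : ∀ c, Continuous (magneticDeriv A c f)) :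
    ∫ q in unitSquare, magneticDensity A f q
      = (∫ y in (0 : ℝ)..1, ∫ s in (0 : ℝ)..1, ‖magneticDeriv A 0 f (s, y)‖ ^ 2)
        + ∫ x in (0 : ℝ)..1, ∫ t in (0 : ℝ)..1, ‖magneticDeriv A 1 f (x, t)‖ ^ 2 := by
  have hInt (c : Fin 2) : Continuous fun q => ‖magneticDeriv A c f q‖ ^ 2 := (hD c).norm.pow 2
  have hQ (c : Fin 2) : IntegrableOn (fun q => ‖magneticDeriv A c f q‖ ^ 2) unitSquare :=
    (hInt c).continuousOn.integrableOn_compact isCompact_unitSquare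
  simp only [magneticDensity, Fin.sum_univ_two]
  rw [integral_add (hQ 0) (hQ 1), setIntegral_unitSquare (hInt 0), setIntegral_unitSquare (hInt 1),
    integral_integral_swap_of_continuous (hInt 0)]

/-- By the diamagnetic inequality the oscillation of `‖f‖` along a segment is controlled by the
magnetic derivative. -/
lemma mean_sq_norm_unitSquare_le (hf : ContDiff ℝ 1 f) {A : Plane → Plane}
    (hD : ∀ c, Continuous (magneticDeriv A c f)) {T : Set Plane} {l m : ℝ}
    (hT : MeasurableSet T) (hl : 0 ≤ l) (hlm : l ≤ m) (hm : m ≤ 1)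
    (hTlm : T ⊆ Icc l m ×ˢ Icc 0 1) (hδ : 0 < δ) :
    volume.real T * ∫ q in unitSquare, ‖f q‖ ^ 2
      ≤ (1 + δ) * (∫ p in T, ‖f p‖ ^ 2)
        + 2 * (1 + δ⁻¹) * (m - l) * ∫ q in unitSquare, magneticDensity A f q := by
  have hfc : Continuous f := hf.continuous
  have hdf : Differentiable ℝ f := hf.differentiable one_ne_zero
  have hvol : volume.real T ≤ m - l := by
    refine (measureReal_mono hTlm (isCompact_Icc.prod isCompact_Icc).measure_ne_top).trans_eq ?_
    rw [Measure.volume_eq_prod, measureReal_prod_prod, Real.volume_real_Icc_of_le hlm,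
      Real.volume_real_Icc_of_le zero_le_one, sub_zero, mul_one]
  have hgx : Continuous fun y => ∫ s in (0 : ℝ)..1, ‖magneticDeriv A 0 f (s, y)‖ ^ 2 :=
    intervalIntegral.continuous_parametric_intervalIntegral_of_continuous'
      (f := fun y s => ‖magneticDeriv A 0 f (s, y)‖ ^ 2) (by fun_prop) 0 1
  have hgy : Continuous fun x => ∫ t in (0 : ℝ)..1, ‖magneticDeriv A 1 f (x, t)‖ ^ 2 :=
    intervalIntegral.continuous_parametric_intervalIntegral_of_continuous'
      (f := fun x t => ‖magneticDeriv A 1 f (x, t)‖ ^ 2) (by fun_prop) 0 1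
  have hmean := mean_sq_unitSquare_le (u := fun p => ‖f p‖) (by fun_prop) hgx hgy
    (fun y s hs t ht => by
      simpa only [sub_zero, one_mul] using! sq_norm_sub_norm_le_integral
        (fun s => hasDerivAt_slice_fst hdf s y)
        (A := fun s => component 0 (A (s, y))) ((hD 0).comp (.prodMk_left y)) hs ht)
    (fun x s hs t ht => by
      simpa only [sub_zero, one_mul] using! sq_norm_sub_norm_le_integral
        (fun t => hasDerivAt_slice_snd hdf x t)
        (A := fun t => component 1 (A (x, t))) ((hD 1).comp (.prodMk_right x)) hs ht)
    hT hlm (hTlm.trans (prod_mono (Icc_subset_Icc hl hm) subset_rfl)) hTlm hδ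
  refine hmean.trans ?_
  rw [setIntegral_unitSquare_magneticDensity hD, mul_assoc _ (m - l), mul_add (m - l)]
  gcongr
  exact intervalIntegral.integral_nonneg zero_le_one fun _ _ =>
    intervalIntegral.integral_nonneg zero_le_one fun _ _ => sq_nonneg _

/-- The square of the points of the unit square at distance at least `R` from its boundary. -/
def innerSquare (R : ℝ) : Set Plane := Icc R (1 - R) ×ˢ Icc R (1 - R)

lemma isCompact_innerSquare (R : ℝ) : IsCompact (innerSquare R) := isCompact_Icc.prod isCompact_Icc

lemma innerSquare_subset_unitSquare (hR : 0 ≤ R) : innerSquare R ⊆ unitSquare :=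
  prod_mono (Icc_subset_Icc hR (by linarith)) (Icc_subset_Icc hR (by linarith))

lemma volume_real_innerSquare (hR : R ≤ 1 / 2) : volume.real (innerSquare R) = (1 - 2 * R) ^ 2 := by
  rw [innerSquare, Measure.volume_eq_prod, measureReal_prod_prod,
    Real.volume_real_Icc_of_le (by linarith)]
  ring

lemma setIntegral_unitSquare_sq_norm_le (hf : ContDiff ℝ 1 f) (hb : b ∉ tsupport f)
    (hbR : b ∈ innerSquare R) (hα : 0 < α) (hα' : 4 * π * α ≤ 1) (hR : 0 < R) (hδ : 0 < δ) :
    ∫ q in unitSquare, ‖f q‖ ^ 2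
      ≤ ((1 + δ) / (2 * π * α) + 4 * (1 + δ⁻¹) / (π * R))
        * ∫ q in unitSquare, magneticDensity (abPotential α b) f q := by
  obtain ⟨⟨hb₁, hb₁'⟩, hb₂, hb₂'⟩ := hbR
  have hD := continuous_magneticDeriv_abPotential hf hb α
  have hsub : disc b R ⊆ Icc (b.1 - R) (b.1 + R) ×ˢ Icc 0 1 :=
    (disc_subset_Icc_prod_Icc b hR.le).trans
      (prod_mono subset_rfl (Icc_subset_Icc (by linarith) (by linarith)))
  have hsubQ : disc b R ⊆ unitSquare :=
    hsub.trans (prod_mono (Icc_subset_Icc (by linarith) (by linarith)) subset_rfl)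
  have hmean := mean_sq_norm_unitSquare_le hf hD (measurableSet_disc b R) (by linarith)
    (by linarith) (by linarith) hsub hδ
  set Q := ∫ q in unitSquare, magneticDensity (abPotential α b) f q with hQ
  have hdisc : ∫ a in disc b R, ‖f a‖ ^ 2 ≤ R ^ 2 / (2 * α) * Q := by
    rw [← inv_div, ← div_eq_inv_mul, le_div_iff₀' (by positivity)]
    exact (hardy_disc hf hb hα.le hα' hR).trans <| setIntegral_mono_set
      ((continuous_magneticDensity hD).continuousOn.integrableOn_compact isCompact_unitSquare)
      (.of_forall fun _ => magneticDensity_nonneg _ _ _) hsubQ.eventuallyLE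
  rw [volume_real_disc b hR.le] at hmean
  refine le_of_mul_le_mul_left (a := π * R ^ 2) ?_ (by positivity)
  calc π * R ^ 2 * ∫ q in unitSquare, ‖f q‖ ^ 2
      ≤ (1 + δ) * (R ^ 2 / (2 * α) * Q) + 2 * (1 + δ⁻¹) * (b.1 + R - (b.1 - R)) * Q :=
        hmean.trans (by gcongr)
    _ = π * R ^ 2 * (((1 + δ) / (2 * π * α) + 4 * (1 + δ⁻¹) / (π * R)) * Q) := by
        field_simp
        ring

lemma mul_setIntegral_unitSquare_sq_norm_le (hf : ContDiff ℝ 1 f) (hb : b ∉ tsupport f)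
    (hR : 0 ≤ R) (hR' : R ≤ 1 / 2) (hδ : 0 < δ) :
    (1 - 2 * R) ^ 2 * ∫ q in unitSquare, ‖f q‖ ^ 2
      ≤ (1 + δ) * (∫ p in innerSquare R, ‖f p‖ ^ 2)
        + 2 * (1 + δ⁻¹) * ∫ q in unitSquare, magneticDensity (abPotential α b) f q := by
  simpa [volume_real_innerSquare hR'] using
    mean_sq_norm_unitSquare_le hf (continuous_magneticDeriv_abPotential hf hb α)
      (isCompact_innerSquare R).measurableSet le_rfl zero_le_one le_rfl
      (innerSquare_subset_unitSquare hR) hδ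

end OneParticle

/-! ### Two particles -/

section Slices

variable {X : Type*} [TopologicalSpace X] [T2Space X] [SecondCountableTopology X]
  [MeasurableSpace X] [BorelSpace X] {μ : Measure X} [IsLocallyFiniteMeasure μ]
  {h n e : X → X → ℝ} {S Q : Set X}

lemma integrableOn_prod_of_continuous (hh : Continuous fun p : X × X => h p.1 p.2)
    (hS : IsCompact S) (hQ : IsCompact Q) :
    Integrable (fun p : X × X => h p.1 p.2) ((μ.restrict S).prod (μ.restrict Q)) := by
  rw [Measure.prod_restrict]
  exact hh.continuousOn.integrableOn_compact (hS.prod hQ)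

/-- Bound `∫ n` by `∫ e` with the second variable in `S`, then let that variable range over `Q`,
exchanging the roles of the two variables. -/
lemma setIntegral_setIntegral_le_of_slices (hn : Continuous fun p : X × X => n p.1 p.2)
    (he : Continuous fun p : X × X => e p.1 p.2) (he0 : ∀ a b, 0 ≤ e a b)
    (hS : IsCompact S) (hQ : IsCompact Q) (hSQ : S ⊆ Q) {c p q K : ℝ} (hp : 0 ≤ p) (hK : 0 ≤ K)
    (hfst : ∀ b ∈ S, ∫ a in Q, n a b ∂μ ≤ K * ∫ a in Q, e a b ∂μ)
    (hsnd : ∀ a ∈ Q, c * ∫ b in Q, n a b ∂μ ≤ p * (∫ b in S, n a b ∂μ) + q * ∫ b in Q, e b a ∂μ) :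
    c * ∫ a in Q, ∫ b in Q, n a b ∂μ ∂μ ≤ (p * K + q) * ∫ b in Q, ∫ a in Q, e a b ∂μ ∂μ := by
  have hnQS := integrableOn_prod_of_continuous (μ := μ) hn hQ hS
  have hnQQ := integrableOn_prod_of_continuous (μ := μ) hn hQ hQ
  have heQS := (integrableOn_prod_of_continuous (μ := μ) he hQ hS).integral_prod_right
  have heQQ := (integrableOn_prod_of_continuous (μ := μ) he hQ hQ).integral_prod_right
  have hinner : ∫ a in Q, ∫ b in S, n a b ∂μ ∂μ ≤ K * ∫ b in Q, ∫ a in Q, e a b ∂μ ∂μ :=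
    calc ∫ a in Q, ∫ b in S, n a b ∂μ ∂μ = ∫ b in S, ∫ a in Q, n a b ∂μ ∂μ :=
          integral_integral_swap hnQS
      _ ≤ ∫ b in S, K * ∫ a in Q, e a b ∂μ ∂μ :=
          setIntegral_mono_on hnQS.integral_prod_right (heQS.const_mul K) hS.measurableSet hfst
      _ = K * ∫ b in S, ∫ a in Q, e a b ∂μ ∂μ := integral_const_mul _ _
      _ ≤ K * ∫ b in Q, ∫ a in Q, e a b ∂μ ∂μ := mul_le_mul_of_nonneg_left
          (setIntegral_mono_set heQQ (.of_forall fun b => integral_nonneg fun a => he0 a b)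
            hSQ.eventuallyLE) hK
  calc c * ∫ a in Q, ∫ b in Q, n a b ∂μ ∂μ
      = ∫ a in Q, c * ∫ b in Q, n a b ∂μ ∂μ := (integral_const_mul _ _).symm
    _ ≤ ∫ a in Q, (p * (∫ b in S, n a b ∂μ) + q * ∫ b in Q, e b a ∂μ) ∂μ :=
        setIntegral_mono_on (hnQQ.integral_prod_left.const_mul c)
          ((hnQS.integral_prod_left.const_mul p).add (heQQ.const_mul q)) hQ.measurableSet hsnd
    _ = p * (∫ a in Q, ∫ b in S, n a b ∂μ ∂μ) + q * ∫ b in Q, ∫ a in Q, e a b ∂μ ∂μ := by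
        rw [integral_add (hnQS.integral_prod_left.const_mul p) (heQQ.const_mul q),
          integral_const_mul, integral_const_mul]
    _ ≤ p * (K * ∫ b in Q, ∫ a in Q, e a b ∂μ ∂μ) + q * ∫ b in Q, ∫ a in Q, e a b ∂μ ∂μ := by
        gcongr
    _ = (p * K + q) * ∫ b in Q, ∫ a in Q, e a b ∂μ ∂μ := by ring

end Slices

lemma mul_integral_sq_norm_le_of_symmetric {ψ : Plane → Plane → ℂ} (hsymm : ∀ a b, ψ a b = ψ b a)
    (hψ : Continuous fun p : Plane × Plane => ψ p.1 p.2)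
    (hslice : ∀ b, ContDiff ℝ 1 fun a => ψ a b) (hdiag : ∀ b, b ∉ tsupport fun a => ψ a b)
    {α R δ : ℝ} (hdens : Continuous fun p : Plane × Plane =>
      magneticDensity (abPotential α p.2) (fun a => ψ a p.2) p.1)
    (hα : 0 < α) (hα' : 4 * π * α ≤ 1) (hR : 0 < R) (hR' : R ≤ 1 / 2) (hδ : 0 < δ) :
    (1 - 2 * R) ^ 2 * ∫ a in unitSquare, ∫ b in unitSquare, ‖ψ a b‖ ^ 2
      ≤ ((1 + δ) * ((1 + δ) / (2 * π * α) + 4 * (1 + δ⁻¹) / (π * R)) + 2 * (1 + δ⁻¹))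
        * ∫ b in unitSquare, ∫ a in unitSquare,
            magneticDensity (abPotential α b) (fun a => ψ a b) a := by
  refine setIntegral_setIntegral_le_of_slices (n := fun a b => ‖ψ a b‖ ^ 2)
    (e := fun a b => magneticDensity (abPotential α b) (fun a => ψ a b) a) (by fun_prop) hdens
    (fun _ _ => magneticDensity_nonneg _ _ _) (isCompact_innerSquare R) isCompact_unitSquare
    (innerSquare_subset_unitSquare hR.le) (by positivity) (by positivity) (fun b hb => ?_)
    fun a _ => ?_
  · exact setIntegral_unitSquare_sq_norm_le (hslice b) (hdiag b) hb hα hα' hR hδ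
  · simp_rw [hsymm a]
    exact mul_setIntegral_unitSquare_sq_norm_le (hslice a) (hdiag a) hR.le hR' hδ

/-! ### Test functions and the variational principle -/

/-- The energy density `|D_j φ|²` of the `j`-th particle. -/
noncomputable def momentumDensity {N : ℕ} (α : ℝ) (j : Fin N) (φ : Config N → ℂ) (x : Config N) :
    ℝ :=
  ∑ c, ‖momentum α j c φ x‖ ^ 2

lemma continuousAt_vecPot {N : ℕ} (j : Fin N) {x : Config N} (hx : x ∉ diagonals N) :
    ContinuousAt (vecPot j) x := by
  refine tendsto_finsetSum _ fun k hk => ?_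
  have hjk : x j - x k ≠ 0 :=
    sub_ne_zero.2 fun h => hx ⟨j, k, (Finset.ne_of_mem_erase hk).symm, h⟩
  exact (continuousAt_perpInv hjk).comp (f := fun x : Config N => x j - x k) (by fun_prop)

lemma momentum_eq_magneticDeriv {N : ℕ} {φ : Config N → ℂ} (hφ : Differentiable ℝ φ) (α : ℝ)
    (j : Fin N) (c : Fin 2) (x : Config N) :
    momentum α j c φ x = magneticDeriv (fun a => α • vecPot j (Function.update x j a)) c
      (fun a => φ (Function.update x j a)) (x j) := by
  have hderiv : fderiv ℝ (fun a => φ (Function.update x j a)) (x j)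
      = (fderiv ℝ φ x).comp (.pi (Pi.single j (.id ℝ Plane))) := by
    refine HasFDerivAt.fderiv (HasFDerivAt.comp (x j) ?_ (hasFDerivAt_update x (x j)))
    rw [Function.update_eq_self]
    exact (hφ x).hasFDerivAt
  have hsingle : ContinuousLinearMap.pi (Pi.single j (.id ℝ Plane)) (unitVec c)
      = (Pi.single j (unitVec c) : Config N) := by
    ext1 k
    rcases eq_or_ne k j with rfl | hkj
    · simp
    · simp [hkj]
  rw [magneticDeriv, hderiv, ContinuousLinearMap.comp_apply, hsingle, Function.update_eq_self,
    momentum]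
  congr 3
  fin_cases c <;> simp [component]

lemma momentum_const_mul {N : ℕ} {φ : Config N → ℂ} (hφ : Differentiable ℝ φ) (α : ℝ) (j : Fin N)
    (c : Fin 2) (k : ℂ) (x : Config N) :
    momentum α j c (fun x => k * φ x) x = k * momentum α j c φ x := by
  simp only [momentum, fderiv_const_mul (hφ x) k, smul_apply, smul_eq_mul]
  ring

namespace IsCore

variable {N : ℕ} {φ : Config N → ℂ}

lemma differentiable (hφ : IsCore φ) : Differentiable ℝ φ := hφ.smooth.differentiable (by simp)

lemma continuous_momentum (hφ : IsCore φ) (α : ℝ) (j : Fin N) (c : Fin 2) :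
    Continuous (momentum α j c φ) := by
  have hdφ : Continuous (fderiv ℝ φ) := hφ.smooth.continuous_fderiv (by simp)
  refine Continuous.add (by fun_prop) <|
    continuous_mul_of_continuousAt_tsupport hφ.smooth.continuous fun x hx => ?_
  have hpot := continuousAt_vecPot j (disjoint_left.1 hφ.off_diagonal hx)
  exact Complex.continuous_ofReal.continuousAt.comp
    (continuousAt_const.mul ((continuous_component c).continuousAt.comp hpot))

lemma continuous_momentumDensity (hφ : IsCore φ) (α : ℝ) (j : Fin N) :
    Continuous (momentumDensity α j φ) :=
  continuous_finsetSum _ fun c _ => (hφ.continuous_momentum α j c).norm.pow 2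

lemma memLp (hφ : IsCore φ) : MemLp φ 2 volume :=
  hφ.smooth.continuous.memLp_of_hasCompactSupport hφ.compact

lemma memLp_momentum (hφ : IsCore φ) (α : ℝ) (j : Fin N) (c : Fin 2) :
    MemLp (momentum α j c φ) 2 volume := by
  have hderiv : HasCompactSupport fun x => fderiv ℝ φ x (Pi.single j (unitVec c)) :=
    (hφ.compact.fderiv (𝕜 := ℝ)).comp_left (g := fun L : Config N →L[ℝ] ℂ => L _) (by simp)
  exact (hφ.continuous_momentum α j c).memLp_of_hasCompactSupport
    ((hderiv.mul_left (f := fun _ => -I)).add hφ.compact.mul_left)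

lemma inGraph (hφ : IsCore φ) (α : ℝ) : InGraph α φ fun j c => momentum α j c φ where
  memLp := hφ.memLp
  memLp_momentum := hφ.memLp_momentum α
  approx := ⟨fun _ => φ, fun _ => hφ, by simp, by simp⟩

lemma const_mul (hφ : IsCore φ) (k : ℂ) : IsCore fun x => k * φ x where
  smooth := contDiff_const.mul hφ.smooth
  compact := hφ.compact.mul_left
  off_diagonal := hφ.off_diagonal.mono_left (tsupport_mul_subset_right (f := fun _ => k))
  symmetric σ x := by rw [hφ.symmetric]

end IsCore

section SqNorm

variable {X E : Type*} [MeasurableSpace X] {μ : Measure X} [NormedAddCommGroup E]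

lemma toReal_eLpNorm_two_sq {f : X → E} (hf : MemLp f 2 μ) :
    (eLpNorm f 2 μ).toReal ^ 2 = ∫ x, ‖f x‖ ^ 2 ∂μ := by
  have hnonneg : 0 ≤ ∫ x, ‖f x‖ ^ 2 ∂μ := integral_nonneg fun _ => sq_nonneg _
  rw [hf.eLpNorm_eq_integral_rpow_norm two_ne_zero ENNReal.ofNat_ne_top]
  simp only [ENNReal.toReal_ofNat, Real.rpow_ofNat]
  rw [ENNReal.toReal_ofReal (by positivity), ← Real.rpow_natCast, ← Real.rpow_mul hnonneg]
  norm_num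

lemma tendsto_setIntegral_sq_norm {ι : Type*} {l : Filter ι} {f : ι → X → E} {g : X → E}
    (hf : ∀ i, MemLp (f i) 2 μ) (hg : MemLp g 2 μ)
    (h : Tendsto (fun i => eLpNorm (f i - g) 2 μ) l (𝓝 0)) (s : Set X) :
    Tendsto (fun i => ∫ x in s, ‖f i x‖ ^ 2 ∂μ) l (𝓝 (∫ x in s, ‖g x‖ ^ 2 ∂μ)) := by
  have hfs (i : ι) : MemLp (f i) 2 (μ.restrict s) := (hf i).restrict s
  have hgs : MemLp g 2 (μ.restrict s) := hg.restrict s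
  have hs : Tendsto (fun i => eLpNorm (f i - g) 2 (μ.restrict s)) l (𝓝 0) :=
    tendsto_of_tendsto_of_tendsto_of_le_of_le tendsto_const_nhds h (fun _ => zero_le)
      fun i => eLpNorm_mono_measure _ Measure.restrict_le_self
  simpa only [Lp.norm_toLp, toReal_eLpNorm_two_sq hgs, toReal_eLpNorm_two_sq (hfs _)] using
    ((Lp.tendsto_Lp_iff_tendsto_eLpNorm'' f hfs g hgs).2 hs).norm.pow 2

end SqNorm

lemma InGraph.tendsto_setIntegral {N : ℕ} {α : ℝ} {Ψ : Config N → ℂ}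
    {Φ : Fin N → Fin 2 → Config N → ℂ} (h : InGraph α Ψ Φ) (s : Set (Config N)) :
    ∃ φ : ℕ → Config N → ℂ, (∀ n, IsCore (φ n)) ∧
      Tendsto (fun n => ∫ x in s, ‖φ n x‖ ^ 2) atTop (𝓝 (∫ x in s, ‖Ψ x‖ ^ 2)) ∧
      Tendsto (fun n => ∑ j, ∫ x in s, momentumDensity α j (φ n) x) atTop
        (𝓝 (∑ j, ∫ x in s, ∑ c, ‖Φ j c x‖ ^ 2)) := by
  obtain ⟨φ, hφ, hlim, hlim'⟩ := h.approx
  refine ⟨φ, hφ, tendsto_setIntegral_sq_norm (fun n => (hφ n).memLp) h.memLp hlim s,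
    tendsto_finsetSum _ fun j _ => ?_⟩
  have hsum (Θ : Fin 2 → Config N → ℂ) (hΘ : ∀ c, MemLp (Θ c) 2 volume) :
      ∫ x in s, ∑ c, ‖Θ c x‖ ^ 2 = ∑ c, ∫ x in s, ‖Θ c x‖ ^ 2 :=
    integral_finsetSum _ fun c _ => ((hΘ c).restrict s).integrable_norm_pow two_ne_zero
  simp only [momentumDensity, hsum _ (h.memLp_momentum j),
    hsum (fun c => momentum α j c (φ _)) ((hφ _).memLp_momentum α j)]
  exact tendsto_finsetSum _ fun c _ => tendsto_setIntegral_sq_norm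
    (fun n => (hφ n).memLp_momentum α j c) (h.memLp_momentum j c) (hlim' j c) s

section Variational

variable {N : ℕ} {α : ℝ} {Ω : Set Plane} {φ : Config N → ℂ}

lemma IsCore.exists_inGraph_normalized (hφ : IsCore φ)
    (hnorm : 0 < ∫ x in power N Ω, ‖φ x‖ ^ 2) :
    ∃ (Ψ : Config N → ℂ) (Φ : Fin N → Fin 2 → Config N → ℂ),
      InGraph α Ψ Φ ∧ ∫ x in power N Ω, ‖Ψ x‖ ^ 2 = 1 ∧
      (∑ j, ∫ x in power N Ω, momentumDensity α j φ x) / ∫ x in power N Ω, ‖φ x‖ ^ 2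
        = ∑ j, ∫ x in power N Ω, ∑ c, ‖Φ j c x‖ ^ 2 := by
  set n := ∫ x in power N Ω, ‖φ x‖ ^ 2 with hn
  set k : ℂ := (((√n)⁻¹ : ℝ) : ℂ) with hk
  have hk2 : ‖k‖ ^ 2 = n⁻¹ := by
    rw [hk, Complex.norm_real, Real.norm_eq_abs, sq_abs, inv_pow, Real.sq_sqrt hnorm.le]
  refine ⟨_, _, (hφ.const_mul k).inGraph α, ?_, ?_⟩
  · simp_rw [norm_mul, mul_pow, hk2]
    rw [integral_const_mul, ← hn, inv_mul_cancel₀ hnorm.ne']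
  · simp_rw [momentum_const_mul hφ.differentiable, norm_mul, mul_pow, hk2, ← Finset.mul_sum,
      integral_const_mul]
    rw [← Finset.mul_sum, div_eq_inv_mul]
    rfl

lemma IsCore.neumannEnergyOn_le (hφ : IsCore φ) (α : ℝ)
    (hnorm : 0 < ∫ x in power N Ω, ‖φ x‖ ^ 2) :
    neumannEnergyOn N α Ω
      ≤ (∑ j, ∫ x in power N Ω, momentumDensity α j φ x) / ∫ x in power N Ω, ‖φ x‖ ^ 2 := by
  refine csInf_le ⟨0, ?_⟩ (hφ.exists_inGraph_normalized hnorm)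
  rintro e ⟨Ψ, Φ, -, -, rfl⟩
  exact Finset.sum_nonneg fun _ _ => integral_nonneg fun _ => Finset.sum_nonneg fun _ _ =>
    sq_nonneg _

lemma le_neumannEnergyOn (hφ : IsCore φ) (hnorm : 0 < ∫ x in power N Ω, ‖φ x‖ ^ 2) {k : ℝ}
    (hcore : ∀ φ : Config N → ℂ, IsCore φ →
      k * ∫ x in power N Ω, ‖φ x‖ ^ 2 ≤ ∑ j, ∫ x in power N Ω, momentumDensity α j φ x) :
    k ≤ neumannEnergyOn N α Ω := by
  refine le_csInf ⟨_, hφ.exists_inGraph_normalized hnorm⟩ ?_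
  rintro e ⟨Ψ, Φ, hΨ, hone, rfl⟩
  obtain ⟨φ, hφ, hlim, hlim'⟩ := hΨ.tendsto_setIntegral (power N Ω)
  rw [hone] at hlim
  simpa using le_of_tendsto_of_tendsto' (hlim.const_mul k) hlim' fun n => hcore _ (hφ n)

end Variational

/-! ### Two-particle test functions -/

@[fun_prop]
lemma contDiff_pair {n : WithTop ℕ∞} :
    ContDiff ℝ n fun p : Plane × Plane => (![p.1, p.2] : Config 2) := by
  refine contDiff_pi.2 fun i => ?_
  fin_cases i
  exacts [contDiff_fst, contDiff_snd]

lemma continuous_pair : Continuous fun p : Plane × Plane => (![p.1, p.2] : Config 2) :=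
  (contDiff_pair (n := 0)).continuous

lemma setIntegral_power_two {G : Config 2 → ℝ} (hG : Continuous G) {K : Set Plane}
    (hK : IsCompact K) : ∫ x in power 2 K, G x = ∫ a in K, ∫ b in K, G ![a, b] := by
  have hpre : (fun x : Config 2 => (x 0, x 1)) ⁻¹' (K ×ˢ K) = power 2 K := by
    ext x
    simp [power, Set.mem_pi, Fin.forall_fin_two]
  have heta (x : Config 2) : ![x 0, x 1] = x := by
    ext1 i
    fin_cases i <;> rfl
  have hprod := (volume_preserving_finTwoArrow Plane).setIntegral_preimage_emb
    MeasurableEquiv.finTwoArrow.measurableEmbedding (fun p => G ![p.1, p.2]) (K ×ˢ K)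
  simp only [MeasurableEquiv.finTwoArrow_apply, heta, hpre] at hprod
  rw [hprod, Measure.volume_eq_prod, setIntegral_prod]
  exact (hG.comp continuous_pair).continuousOn.integrableOn_compact (hK.prod hK)

section Pair

variable {φ : Config 2 → ℂ}

lemma momentumDensity_zero_pair (hφ : Differentiable ℝ φ) (α : ℝ) (a b : Plane) :
    momentumDensity α 0 φ ![a, b]
      = magneticDensity (abPotential α b) (fun a => φ ![a, b]) a := by
  have hupdate (a' : Plane) : Function.update (![a, b] : Config 2) 0 a' = ![a', b] :=
    Fin.update_cons_zero _ _ _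
  have hpot (a' : Plane) : vecPot 0 ![a', b] = perpInv (a' - b) := by
    simp [vecPot, show (Finset.univ : Finset (Fin 2)).erase 0 = {1} by decide]
  simp only [momentumDensity, momentum_eq_magneticDeriv hφ, hupdate, hpot]
  rfl

lemma momentumDensity_one_pair (hφ : Differentiable ℝ φ) (α : ℝ) (a b : Plane) :
    momentumDensity α 1 φ ![a, b]
      = magneticDensity (abPotential α a) (fun b => φ ![a, b]) b := by
  have hupdate (b' : Plane) : Function.update (![a, b] : Config 2) 1 b' = ![a, b'] := by
    ext1 i
    fin_cases i <;> rfl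
  have hpot (b' : Plane) : vecPot 1 ![a, b'] = perpInv (b' - a) := by
    simp [vecPot, show (Finset.univ : Finset (Fin 2)).erase 1 = {0} by decide]
  simp only [momentumDensity, momentum_eq_magneticDeriv hφ, hupdate, hpot]
  rfl

namespace IsCore

lemma apply_pair_comm (hφ : IsCore φ) (a b : Plane) : φ ![a, b] = φ ![b, a] := by
  rw [← hφ.symmetric (Equiv.swap 0 1) ![a, b]]
  congr 1
  ext1 i
  fin_cases i <;> rfl

lemma notMem_tsupport_slice (hφ : IsCore φ) (b : Plane) : b ∉ tsupport fun a => φ ![a, b] :=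
  fun hb => disjoint_left.1 hφ.off_diagonal
    (tsupport_comp_subset_preimage φ (continuous_pair.comp (.prodMk_left b)) hb)
    ⟨0, 1, zero_ne_one, rfl⟩

lemma continuous_magneticDensity_pair (hφ : IsCore φ) (α : ℝ) :
    Continuous fun p : Plane × Plane =>
      magneticDensity (abPotential α p.2) (fun a => φ ![a, p.2]) p.1 := by
  simp_rw [← momentumDensity_zero_pair hφ.differentiable]
  exact (hφ.continuous_momentumDensity α 0).comp continuous_pair

lemma sum_setIntegral_momentumDensity (hφ : IsCore φ) (α : ℝ) {K : Set Plane} (hK : IsCompact K) :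
    ∑ j, ∫ x in power 2 K, momentumDensity α j φ x
      = 2 * ∫ b in K, ∫ a in K, magneticDensity (abPotential α b) (fun a => φ ![a, b]) a := by
  rw [Fin.sum_univ_two, setIntegral_power_two (hφ.continuous_momentumDensity α 0) hK,
    setIntegral_power_two (hφ.continuous_momentumDensity α 1) hK]
  simp_rw [momentumDensity_zero_pair hφ.differentiable, momentumDensity_one_pair hφ.differentiable,
    fun a => hφ.apply_pair_comm a]
  rw [integral_integral_swap (integrableOn_prod_of_continuous ?_ hK hK), two_mul]
  simpa only [fun a => hφ.apply_pair_comm a] using hφ.continuous_magneticDensity_pair α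

lemma mul_setIntegral_sq_norm_le (hφ : IsCore φ) {α R δ : ℝ} (hα : 0 < α) (hα' : 4 * π * α ≤ 1)
    (hR : 0 < R) (hR' : R ≤ 1 / 2) (hδ : 0 < δ) :
    2 * ((1 - 2 * R) ^ 2 * ∫ x in power 2 unitSquare, ‖φ x‖ ^ 2)
      ≤ ((1 + δ) * ((1 + δ) / (2 * π * α) + 4 * (1 + δ⁻¹) / (π * R)) + 2 * (1 + δ⁻¹))
        * ∑ j, ∫ x in power 2 unitSquare, momentumDensity α j φ x := by
  have hφc : Continuous φ := hφ.smooth.continuous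
  have hslice (b : Plane) : ContDiff ℝ 1 fun a => φ ![a, b] :=
    (hφ.smooth.of_le (by simp)).comp (contDiff_pair.comp (contDiff_prodMk_left b))
  rw [hφ.sum_setIntegral_momentumDensity α isCompact_unitSquare,
    setIntegral_power_two (by fun_prop) isCompact_unitSquare, mul_left_comm _ 2]
  exact mul_le_mul_of_nonneg_left (mul_integral_sq_norm_le_of_symmetric
    (ψ := fun a b => φ ![a, b]) hφ.apply_pair_comm (hφc.comp continuous_pair) hslice
    hφ.notMem_tsupport_slice (hφ.continuous_magneticDensity_pair α) hα hα' hR hR' hδ) zero_le_two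

end IsCore

end Pair

/-! ### Radial test functions -/

/-- The energy density of `a ↦ u (|𝐚 - 𝐛|²)` in the Aharonov–Bohm potential of flux `α` at `b`, as a
function of `t = |𝐚 - 𝐛|²`. -/
noncomputable def radialDensity (α : ℝ) (u : ℝ → ℝ) (t : ℝ) : ℝ :=
  4 * t * deriv u t ^ 2 + α ^ 2 * (u t ^ 2 / t)

lemma magneticDensity_congr {f g : Plane → ℂ} {a : Plane} (h : f =ᶠ[𝓝 a] g) (A : Plane → Plane) :
    magneticDensity A f a = magneticDensity A g a := by
  simp only [magneticDensity, magneticDeriv, h.fderiv_eq, h.eq_of_nhds]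

lemma hasFDerivAt_sqDist (a b : Plane) :
    HasFDerivAt (fun a => sqDist a b) ((2 * (a.1 - b.1)) • ContinuousLinearMap.fst ℝ ℝ ℝ
      + (2 * (a.2 - b.2)) • ContinuousLinearMap.snd ℝ ℝ ℝ) a := by
  have h₁ := ((hasFDerivAt_fst (𝕜 := ℝ) (p := a)).sub_const b.1).pow 2
  have h₂ := ((hasFDerivAt_snd (𝕜 := ℝ) (p := a)).sub_const b.2).pow 2
  refine (h₁.add h₂).congr_fderiv ?_
  ext <;> simp

lemma sq_norm_neg_I_mul_ofReal_add (p q : ℝ) : ‖-I * p + q‖ ^ 2 = p ^ 2 + q ^ 2 := by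
  rw [Complex.sq_norm, Complex.normSq_apply]
  simp
  ring

lemma magneticDensity_radial (α : ℝ) {u : ℝ → ℝ} {a b : Plane}
    (hu : DifferentiableAt ℝ u (sqDist a b)) :
    magneticDensity (abPotential α b) (fun a => (u (sqDist a b) : ℂ)) a
      = radialDensity α u (sqDist a b) := by
  have hderiv (v : Plane) : fderiv ℝ (fun a => (u (sqDist a b) : ℂ)) a v
      = ((2 * ((a.1 - b.1) * v.1 + (a.2 - b.2) * v.2) * deriv u (sqDist a b) : ℝ) : ℂ) := by
    have hcomp := (hu.hasDerivAt.ofReal_comp.hasFDerivAt.comp a (hasFDerivAt_sqDist a b)).fderiv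
    rw [Function.comp_def] at hcomp
    rw [hcomp]
    simp
    ring
  have hsq : (a - b).1 ^ 2 + (a - b).2 ^ 2 = sqDist a b := rfl
  simp only [magneticDensity, magneticDeriv, hderiv, ← Complex.ofReal_mul,
    sq_norm_neg_I_mul_ofReal_add, Fin.sum_univ_two, component, abPotential, perpInv, hsq]
  rcases eq_or_ne (sqDist a b) 0 with h0 | h0
  · simp [sqDist_eq_zero.1 h0, unitVec, sqDist, radialDensity]
  · simp only [unitVec, Matrix.cons_val_zero, Matrix.cons_val_one, Prod.smul_fst, Prod.smul_snd,
      smul_eq_mul, Prod.fst_sub, Prod.snd_sub]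
    rw [radialDensity]
    set t := sqDist a b with ht
    set d := deriv u t
    set v := u t
    field_simp
    rw [ht, sqDist]
    ring

/-- A smooth cutoff, equal to one near the unit square. -/
noncomputable def planeBump : ContDiffBump (0 : Plane) := ⟨2, 3, by norm_num, by norm_num⟩

lemma planeBump_eventuallyEq_one {a : Plane} (ha : a ∈ unitSquare) : planeBump =ᶠ[𝓝 a] 1 := by
  obtain ⟨⟨h₁, h₁'⟩, h₂, h₂'⟩ := ha
  refine planeBump.eventuallyEq_one_of_mem_ball (mem_ball_zero_iff.2 (max_lt ?_ ?_)) <;>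
  · rw [Real.norm_eq_abs, abs_of_nonneg (by assumption)]
    exact lt_of_le_of_lt (by assumption) one_lt_two

/-- The two-particle test function with profile `u` in the squared distance `|𝐱₁ - 𝐱₂|²`. -/
noncomputable def pairTrial (u : ℝ → ℝ) (x : Config 2) : ℂ :=
  ((planeBump (x 0) * planeBump (x 1) * u (sqDist (x 0) (x 1)) : ℝ) : ℂ)

lemma isCore_pairTrial {u : ℝ → ℝ} (hu : ContDiff ℝ ∞ u) {ε : ℝ} (hε : 0 < ε)
    (hu0 : ∀ t ≤ ε, u t = 0) : IsCore (pairTrial u) where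
  smooth := by
    have hdist : ContDiff ℝ ∞ fun x : Config 2 => sqDist (x 0) (x 1) := by
      unfold sqDist; fun_prop
    have hbump (j : Fin 2) : ContDiff ℝ ∞ fun x : Config 2 => planeBump (x j) :=
      planeBump.contDiff.comp (by fun_prop)
    exact Complex.ofRealCLM.contDiff.comp (((hbump 0).mul (hbump 1)).mul (hu.comp hdist))
  compact := by
    refine .intro (isCompact_closedBall (0 : Config 2) 3) fun x hx => ?_
    obtain ⟨j, hj⟩ : ∃ j, 3 < ‖x j‖ := by
      simpa only [mem_closedBall_zero_iff, pi_norm_le_iff_of_nonneg zero_le_three, not_forall,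
        not_le] using hx
    have hbump : planeBump (x j) = 0 :=
      planeBump.zero_of_le_dist ((dist_zero_right (x j)).symm ▸ hj.le)
    fin_cases j <;> simp_all [pairTrial]
  off_diagonal := by
    have hsupp : tsupport (pairTrial u) ⊆ {x | ε ≤ sqDist (x 0) (x 1)} := by
      refine closure_minimal (fun x hx => ?_) (isClosed_le continuous_const (by fun_prop))
      contrapose! hx
      simp [pairTrial, hu0 _ (not_le.1 hx).le]
    refine disjoint_left.2 fun x hx ⟨j, k, hjk, hxjk⟩ => hε.not_ge ?_
    have hx01 : x 0 = x 1 := by fin_cases j <;> fin_cases k <;> simp_all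
    exact (hsupp hx).trans_eq (sqDist_eq_zero.2 hx01)
  symmetric σ x := by
    obtain ⟨h0, h1⟩ | ⟨h0, h1⟩ : σ 0 = 0 ∧ σ 1 = 1 ∨ σ 0 = 1 ∧ σ 1 = 0 := by
      revert σ; decide
    · simp only [pairTrial, Function.comp_apply, h0, h1]
    · simp only [pairTrial, Function.comp_apply, h0, h1, sqDist_comm (x 1),
        mul_comm (planeBump (x 1))]

lemma pairTrial_eventuallyEq (u : ℝ → ℝ) {a b : Plane} (ha : a ∈ unitSquare)
    (hb : b ∈ unitSquare) :
    (fun a => pairTrial u ![a, b]) =ᶠ[𝓝 a] fun a => (u (sqDist a b) : ℂ) := by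
  filter_upwards [planeBump_eventuallyEq_one ha] with a' ha'
  simp [pairTrial, ha', (planeBump_eventuallyEq_one hb).eq_of_nhds]

lemma magneticDensity_pairTrial (α : ℝ) {u : ℝ → ℝ} (hu : Differentiable ℝ u) {a b : Plane}
    (ha : a ∈ unitSquare) (hb : b ∈ unitSquare) :
    magneticDensity (abPotential α b) (fun a => pairTrial u ![a, b]) a
      = radialDensity α u (sqDist a b) := by
  rw [magneticDensity_congr (pairTrial_eventuallyEq u ha hb), magneticDensity_radial α (hu _)]

lemma sq_norm_pairTrial (u : ℝ → ℝ) {a b : Plane} (ha : a ∈ unitSquare) (hb : b ∈ unitSquare) :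
    ‖pairTrial u ![a, b]‖ ^ 2 = u (sqDist a b) ^ 2 := by
  rw [(pairTrial_eventuallyEq u ha hb).eq_of_nhds, Complex.norm_real, Real.norm_eq_abs, sq_abs]

/-! ### Integrals of radial functions over the unit square -/

lemma unitSquare_subset_disc {b : Plane} (hb : b ∈ unitSquare) : unitSquare ⊆ disc b 2 := by
  rintro a ⟨⟨h₁, h₁'⟩, h₂, h₂'⟩
  obtain ⟨⟨h₃, h₃'⟩, h₄, h₄'⟩ := hb
  change (a.1 - b.1) ^ 2 + (a.2 - b.2) ^ 2 < 2 ^ 2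
  nlinarith

lemma setIntegral_disc_rpow_sqDist (b : Plane) {R α : ℝ} (hR : 0 ≤ R) (hα : 0 < α) :
    ∫ a in disc b R, sqDist a b ^ (α - 1) = π * R ^ (2 * α) / α := by
  have hInt : ∫ r in (0 : ℝ)..R, r * (r ^ 2) ^ (α - 1) = ∫ r in (0 : ℝ)..R, r ^ (2 * α - 1) := by
    refine intervalIntegral.integral_congr_ae (.of_forall fun r hr => ?_)
    rw [uIoc_of_le hR] at hr
    rw [← Real.rpow_natCast_mul hr.1.le]
    nth_rw 1 [← Real.rpow_one r]
    rw [← Real.rpow_add hr.1]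
    congr 1
    push_cast
    ring
  rw [setIntegral_disc_sqDist b hR fun t => t ^ (α - 1), hInt, integral_rpow (.inl (by linarith)),
    sub_add_cancel, Real.zero_rpow (by positivity)]
  field_simp
  ring

lemma integrableOn_disc_rpow_sqDist (b : Plane) {R α : ℝ} (hR : 0 < R) (hα : 0 < α) :
    IntegrableOn (fun a => sqDist a b ^ (α - 1)) (disc b R) := by
  refine Integrable.of_integral_ne_zero ?_
  rw [setIntegral_disc_rpow_sqDist b hR.le hα]
  positivity

lemma setIntegral_unitSquare_rpow_sqDist_le {α : ℝ} (hα : 0 < α) {b : Plane}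
    (hb : b ∈ unitSquare) :
    ∫ a in unitSquare, sqDist a b ^ (α - 1) ≤ π * 4 ^ α / α := by
  calc ∫ a in unitSquare, sqDist a b ^ (α - 1)
      ≤ ∫ a in disc b 2, sqDist a b ^ (α - 1) :=
        setIntegral_mono_set (integrableOn_disc_rpow_sqDist b two_pos hα)
          (.of_forall fun a => Real.rpow_nonneg (sqDist_nonneg a b) _)
          (unitSquare_subset_disc hb).eventuallyLE
    _ = π * 4 ^ α / α := by
        rw [setIntegral_disc_rpow_sqDist b zero_le_two hα, Real.rpow_mul zero_le_two]
        norm_num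

lemma integrableOn_unitSquare {H : Plane → ℝ} (hH : Continuous H) : IntegrableOn H unitSquare :=
  hH.continuousOn.integrableOn_compact isCompact_unitSquare

lemma integrableOn_indicator_disc (b : Plane) (R k : ℝ) :
    IntegrableOn ((disc b R).indicator fun _ => k) unitSquare :=
  (integrableOn_unitSquare continuous_const).indicator (measurableSet_disc b R)

lemma volume_disc_ne_top (b : Plane) {R : ℝ} (hR : 0 ≤ R) : volume (disc b R) ≠ ⊤ :=
  ((measure_mono (disc_subset_Icc_prod_Icc b hR)).trans_lt
    (isCompact_Icc.prod isCompact_Icc).measure_lt_top).ne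

lemma setIntegral_unitSquare_indicator_disc_le (b : Plane) {R k : ℝ} (hR : 0 ≤ R) (hk : 0 ≤ k) :
    ∫ a in unitSquare, (disc b R).indicator (fun _ => k) a ≤ k * (π * R ^ 2) := by
  rw [setIntegral_indicator (measurableSet_disc b R), setIntegral_const, smul_eq_mul, mul_comm,
    ← volume_real_disc b hR]
  exact mul_le_mul_of_nonneg_left (measureReal_mono inter_subset_right (volume_disc_ne_top b hR)) hk

section Bounds

variable {F : Plane → Plane → ℝ} (hF : Continuous fun p : Plane × Plane => F p.1 p.2) {k : ℝ}
include hF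

lemma setIntegral_setIntegral_unitSquare_le
    (h : ∀ b ∈ unitSquare, ∫ a in unitSquare, F a b ≤ k) :
    ∫ b in unitSquare, ∫ a in unitSquare, F a b ≤ k := by
  have hInt := (integrableOn_prod_of_continuous (μ := volume) hF isCompact_unitSquare
    isCompact_unitSquare).integral_prod_right
  simpa [volume_real_unitSquare] using setIntegral_mono_on hInt
    (integrableOn_unitSquare continuous_const) measurableSet_unitSquare h

lemma le_setIntegral_setIntegral_unitSquare
    (h : ∀ b ∈ unitSquare, k ≤ ∫ a in unitSquare, F a b) :
    k ≤ ∫ b in unitSquare, ∫ a in unitSquare, F a b := by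
  have hInt := (integrableOn_prod_of_continuous (μ := volume) hF isCompact_unitSquare
    isCompact_unitSquare).integral_prod_right
  simpa [volume_real_unitSquare] using setIntegral_mono_on
    (integrableOn_unitSquare continuous_const) hInt measurableSet_unitSquare h

end Bounds

/-! ### The trial profile -/

/-- The trial profile `t ↦ t ^ (α / 2)` in the squared distance `t = |𝐱₁ - 𝐱₂|²`, that is
`|𝐱₁ - 𝐱₂| ^ α`, cut off smoothly between `t = 2ε` and `t = ε`. -/
noncomputable def profile (α ε t : ℝ) : ℝ := t ^ (α / 2) * Real.smoothTransition (t / ε - 1)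

lemma profile_of_le (α : ℝ) {ε t : ℝ} (hε : 0 < ε) (ht : t ≤ ε) : profile α ε t = 0 := by
  rw [profile, Real.smoothTransition.zero_of_nonpos, mul_zero]
  rwa [sub_nonpos, div_le_one hε]

lemma profile_of_ge (α : ℝ) {ε t : ℝ} (hε : 0 < ε) (ht : 2 * ε ≤ t) :
    profile α ε t = t ^ (α / 2) := by
  rw [profile, Real.smoothTransition.one_of_one_le, mul_one]
  rw [le_sub_iff_add_le, le_div_iff₀ hε]
  linarith

lemma contDiff_profile (α : ℝ) {ε : ℝ} (hε : 0 < ε) : ContDiff ℝ ∞ (profile α ε) := by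
  refine contDiff_iff_contDiffAt.2 fun t => ?_
  rcases lt_or_ge t ε with h | h
  · have hzero : profile α ε =ᶠ[𝓝 t] fun _ => 0 := by
      filter_upwards [Iio_mem_nhds h] with s hs using profile_of_le α hε hs.le
    exact contDiffAt_const.congr_of_eventuallyEq hzero
  · exact (Real.contDiffAt_rpow_const_of_ne (hε.trans_le h).ne').mul
      (Real.smoothTransition.contDiff.contDiffAt.comp t (by fun_prop))

lemma deriv_smoothTransition_eq_zero {x : ℝ} (hx : x ∉ Icc (0 : ℝ) 1) :
    deriv Real.smoothTransition x = 0 := by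
  rcases lt_or_ge x 0 with h | h
  · have hconst : Real.smoothTransition =ᶠ[𝓝 x] fun _ => 0 := by
      filter_upwards [Iio_mem_nhds h] with y hy
        using Real.smoothTransition.zero_of_nonpos (le_of_lt hy)
    rw [hconst.deriv_eq, deriv_const]
  · have hconst : Real.smoothTransition =ᶠ[𝓝 x] fun _ => 1 := by
      filter_upwards [Ioi_mem_nhds (not_le.1 fun h' => hx ⟨h, h'⟩)] with y hy
        using Real.smoothTransition.one_of_one_le (le_of_lt hy)
    rw [hconst.deriv_eq, deriv_const]

lemma exists_abs_deriv_smoothTransition_le : ∃ M, ∀ x, |deriv Real.smoothTransition x| ≤ M :=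
  have hsupp : HasCompactSupport (deriv Real.smoothTransition) :=
    .intro isCompact_Icc fun _ => deriv_smoothTransition_eq_zero
  hsupp.exists_bound_of_continuous
    ((Real.smoothTransition.contDiff (n := 1)).continuous_deriv le_rfl)

lemma hasDerivAt_profile (α ε : ℝ) {t : ℝ} (ht : 0 < t) :
    HasDerivAt (profile α ε) (t ^ (α / 2) * (α / (2 * t) * Real.smoothTransition (t / ε - 1)
      + deriv Real.smoothTransition (t / ε - 1) / ε)) t := by
  have hpow := Real.hasDerivAt_rpow_const (p := α / 2) (.inl ht.ne')
  have hcutoff : HasDerivAt Real.smoothTransition (deriv Real.smoothTransition (t / ε - 1))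
      (t / ε - 1) :=
    ((Real.smoothTransition.contDiff (n := 1)).differentiable one_ne_zero _).hasDerivAt
  refine (hpow.mul (hcutoff.comp t (((hasDerivAt_id t).div_const ε).sub_const 1))).congr_deriv ?_
  rw [Real.rpow_sub_one ht.ne', Function.comp_apply, id]
  field_simp

lemma sq_rpow_half {t : ℝ} (ht : 0 ≤ t) (α : ℝ) : (t ^ (α / 2)) ^ 2 = t ^ α := by
  rw [← Real.rpow_mul_natCast ht]
  norm_num

lemma radialDensity_profile (α ε : ℝ) {t : ℝ} (ht : 0 < t) :
    radialDensity α (profile α ε) t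
      = 2 * α ^ 2 * t ^ (α - 1) * Real.smoothTransition (t / ε - 1) ^ 2
        + t ^ α * (4 * α * Real.smoothTransition (t / ε - 1)
            * (deriv Real.smoothTransition (t / ε - 1) / ε)
          + 4 * t * (deriv Real.smoothTransition (t / ε - 1) / ε) ^ 2) := by
  rw [radialDensity, (hasDerivAt_profile α ε ht).deriv, profile, mul_pow, mul_pow,
    sq_rpow_half ht.le, Real.rpow_sub_one ht.ne']
  generalize deriv Real.smoothTransition (t / ε - 1) / ε = q
  field

section Cutoff

variable {M : ℝ} (hM : ∀ x, |deriv Real.smoothTransition x| ≤ M) {α ε : ℝ} (hα : 0 ≤ α)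
  (hα' : α ≤ 1) (hε : 0 < ε)
include hM hα hα' hε

lemma cutoff_error_le {t : ℝ} (ht : 0 ≤ t) (ht' : t ≤ 2 * ε) :
    t ^ α * (4 * α * Real.smoothTransition (t / ε - 1)
        * (deriv Real.smoothTransition (t / ε - 1) / ε)
      + 4 * t * (deriv Real.smoothTransition (t / ε - 1) / ε) ^ 2)
      ≤ (8 * M + 16 * M ^ 2) * ε ^ (α - 1) := by
  have hM0 : 0 ≤ M := (abs_nonneg _).trans (hM 0)
  set χ := Real.smoothTransition (t / ε - 1)
  set χ' := deriv Real.smoothTransition (t / ε - 1)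
  have hχ : α * χ ≤ 1 := mul_le_one₀ hα' (Real.smoothTransition.nonneg _)
    (Real.smoothTransition.le_one _)
  have hχ0 : 0 ≤ α * χ := mul_nonneg hα (Real.smoothTransition.nonneg _)
  have hχ' : α * χ * χ' ≤ M :=
    (mul_le_mul_of_nonneg_left (le_of_abs_le (hM _)) hχ0).trans (mul_le_of_le_one_left hM0 hχ)
  have hχ'sq : χ' ^ 2 ≤ M ^ 2 := sq_le_sq.2 ((hM _).trans (le_abs_self M))
  have hpow : t ^ α ≤ 2 * ε ^ α := by
    calc t ^ α ≤ (2 * ε) ^ α := Real.rpow_le_rpow ht ht' hα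
      _ = 2 ^ α * ε ^ α := Real.mul_rpow zero_le_two hε.le
      _ ≤ 2 * ε ^ α := by
        gcongr
        exact Real.rpow_le_self_of_one_le one_le_two hα'
  calc t ^ α * (4 * α * χ * (χ' / ε) + 4 * t * (χ' / ε) ^ 2)
      = t ^ α * (4 * (α * χ * χ') / ε + 4 * t * χ' ^ 2 / ε ^ 2) := by ring
    _ ≤ t ^ α * (4 * M / ε + 4 * (2 * ε) * M ^ 2 / ε ^ 2) := by gcongr
    _ ≤ 2 * ε ^ α * (4 * M / ε + 4 * (2 * ε) * M ^ 2 / ε ^ 2) := by gcongr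
    _ = (8 * M + 16 * M ^ 2) * ε ^ (α - 1) := by
      rw [Real.rpow_sub_one hε.ne']
      field_simp
      ring

lemma radialDensity_profile_le (a b : Plane) :
    radialDensity α (profile α ε) (sqDist a b) ≤ 2 * α ^ 2 * sqDist a b ^ (α - 1)
      + (disc b √(3 * ε)).indicator (fun _ => (8 * M + 16 * M ^ 2) * ε ^ (α - 1)) a := by
  have hM0 : 0 ≤ M := (abs_nonneg _).trans (hM 0)
  have herror : 0 ≤ (disc b √(3 * ε)).indicator
      (fun _ => (8 * M + 16 * M ^ 2) * ε ^ (α - 1)) a :=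
    indicator_nonneg (fun _ _ => by positivity) a
  rcases (sqDist_nonneg a b).eq_or_lt with ht | ht
  · have hmain := Real.rpow_nonneg (sqDist_nonneg a b) (α - 1)
    rw [← ht] at hmain ⊢
    simp only [radialDensity, mul_zero, zero_mul, div_zero, add_zero]
    positivity
  rw [radialDensity_profile α ε ht]
  refine add_le_add (mul_le_of_le_one_right (by positivity) (pow_le_one₀
    (Real.smoothTransition.nonneg _) (Real.smoothTransition.le_one _))) ?_
  by_cases hχ : sqDist a b / ε - 1 ∈ Icc (0 : ℝ) 1
  · have ht' : sqDist a b ≤ 2 * ε := by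
      rw [← div_le_iff₀ hε]
      linarith [hχ.2]
    have hmem : a ∈ disc b √(3 * ε) := by
      change sqDist a b < √(3 * ε) ^ 2
      rw [Real.sq_sqrt (by positivity)]
      linarith
    rw [indicator_of_mem hmem]
    exact cutoff_error_le hM hα hα' hε ht.le ht'
  · simpa [deriv_smoothTransition_eq_zero hχ] using herror

end Cutoff

section Trial

variable {α ε : ℝ}

lemma isCore_pairTrial_profile (α : ℝ) (hε : 0 < ε) : IsCore (pairTrial (profile α ε)) :=
  isCore_pairTrial (contDiff_profile α hε) hε fun _ => profile_of_le α hε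

lemma setIntegral_magneticDensity_pairTrial_profile_le {M : ℝ}
    (hM : ∀ x, |deriv Real.smoothTransition x| ≤ M) (hα : 0 < α) (hα' : α ≤ 1) (hε : 0 < ε)
    {b : Plane} (hb : b ∈ unitSquare) :
    ∫ a in unitSquare,
        magneticDensity (abPotential α b) (fun a => pairTrial (profile α ε) ![a, b]) a
      ≤ 2 * π * α * 4 ^ α + 3 * π * (8 * M + 16 * M ^ 2) * ε ^ α := by
  have hM0 : 0 ≤ M := (abs_nonneg _).trans (hM 0)
  have hmain : IntegrableOn (fun a => 2 * α ^ 2 * sqDist a b ^ (α - 1)) unitSquare :=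
    ((integrableOn_disc_rpow_sqDist b two_pos hα).mono_set (unitSquare_subset_disc hb)).const_mul _
  have herror := integrableOn_indicator_disc b √(3 * ε) ((8 * M + 16 * M ^ 2) * ε ^ (α - 1))
  have hdensity : Continuous fun a =>
      magneticDensity (abPotential α b) (fun a => pairTrial (profile α ε) ![a, b]) a :=
    ((isCore_pairTrial_profile α hε).continuous_magneticDensity_pair α).comp₂ continuous_id
      continuous_const
  calc ∫ a in unitSquare,
        magneticDensity (abPotential α b) (fun a => pairTrial (profile α ε) ![a, b]) a
      ≤ ∫ a in unitSquare, (2 * α ^ 2 * sqDist a b ^ (α - 1) + (disc b √(3 * ε)).indicator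
          (fun _ => (8 * M + 16 * M ^ 2) * ε ^ (α - 1)) a) := by
        refine setIntegral_mono_on (integrableOn_unitSquare hdensity) (hmain.add herror)
          measurableSet_unitSquare fun a ha => ?_
        rw [magneticDensity_pairTrial α ((contDiff_profile α hε).differentiable (by simp)) ha hb]
        exact radialDensity_profile_le hM hα.le hα' hε a b
    _ ≤ 2 * α ^ 2 * (π * 4 ^ α / α)
          + (8 * M + 16 * M ^ 2) * ε ^ (α - 1) * (π * √(3 * ε) ^ 2) := by
        rw [integral_add hmain herror, integral_const_mul]
        gcongr
        · exact setIntegral_unitSquare_rpow_sqDist_le hα hb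
        · exact setIntegral_unitSquare_indicator_disc_le b (Real.sqrt_nonneg _) (by positivity)
    _ = 2 * π * α * 4 ^ α + 3 * π * (8 * M + 16 * M ^ 2) * ε ^ α := by
        rw [Real.sq_sqrt (by positivity), Real.rpow_sub_one hε.ne']
        field_simp

lemma sum_setIntegral_momentumDensity_pairTrial_profile_le {M : ℝ}
    (hM : ∀ x, |deriv Real.smoothTransition x| ≤ M) (hα : 0 < α) (hα' : α ≤ 1) (hε : 0 < ε) :
    ∑ j, ∫ x in power 2 unitSquare, momentumDensity α j (pairTrial (profile α ε)) x
      ≤ 4 * π * α * 4 ^ α + 6 * π * (8 * M + 16 * M ^ 2) * ε ^ α := by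
  rw [(isCore_pairTrial_profile α hε).sum_setIntegral_momentumDensity α isCompact_unitSquare]
  have hslices := setIntegral_setIntegral_unitSquare_le
    ((isCore_pairTrial_profile α hε).continuous_magneticDensity_pair α) fun b hb =>
      setIntegral_magneticDensity_pairTrial_profile_le hM hα hα' hε hb
  linarith

lemma le_sq_norm_pairTrial_profile (hα : 0 < α) (hε : 0 < ε) (hεα : 2 * ε ≤ α) {a b : Plane}
    (ha : a ∈ unitSquare) (hb : b ∈ unitSquare) :
    α ^ α - (disc a √α).indicator (fun _ => α ^ α) b
      ≤ ‖pairTrial (profile α ε) ![a, b]‖ ^ 2 := by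
  by_cases hmem : b ∈ disc a √α
  · rw [indicator_of_mem hmem, sub_self]
    positivity
  · have ht : α ≤ sqDist a b := by
      rw [← Real.sq_sqrt hα.le, sqDist_comm]
      exact not_lt.1 hmem
    rw [indicator_of_notMem hmem, sub_zero, sq_norm_pairTrial _ ha hb,
      profile_of_ge α hε (hεα.trans ht), sq_rpow_half (sqDist_nonneg a b)]
    exact Real.rpow_le_rpow hα.le ht hα.le

lemma le_setIntegral_sq_norm_pairTrial_profile (hα : 0 < α) (hε : 0 < ε) (hεα : 2 * ε ≤ α) :
    α ^ α * (1 - π * α) ≤ ∫ x in power 2 unitSquare, ‖pairTrial (profile α ε) x‖ ^ 2 := by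
  have hφ : Continuous fun x => ‖pairTrial (profile α ε) x‖ ^ 2 :=
    (isCore_pairTrial_profile α hε).smooth.continuous.norm.pow 2
  have hpair := hφ.comp (continuous_pair.comp continuous_swap)
  rw [setIntegral_power_two hφ isCompact_unitSquare]
  refine le_setIntegral_setIntegral_unitSquare hpair fun a ha => ?_
  have hone : IntegrableOn (fun _ : Plane => α ^ α) unitSquare :=
    integrableOn_unitSquare continuous_const
  have hdisc := integrableOn_indicator_disc a √α (α ^ α)
  calc α ^ α * (1 - π * α)
      = α ^ α - α ^ α * (π * √α ^ 2) := by rw [Real.sq_sqrt hα.le]; ring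
    _ ≤ α ^ α - ∫ b in unitSquare, (disc a √α).indicator (fun _ => α ^ α) b := by
        gcongr
        exact setIntegral_unitSquare_indicator_disc_le a (Real.sqrt_nonneg α) (by positivity)
    _ = ∫ b in unitSquare, (α ^ α - (disc a √α).indicator (fun _ => α ^ α) b) := by
        rw [integral_sub hone hdisc, setIntegral_const, volume_real_unitSquare, one_smul]
    _ ≤ ∫ b in unitSquare, ‖pairTrial (profile α ε) ![a, b]‖ ^ 2 :=
        setIntegral_mono_on (hone.sub hdisc)
          (integrableOn_unitSquare (hpair.comp₂ continuous_id continuous_const))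
          measurableSet_unitSquare fun b hb => le_sq_norm_pairTrial_profile hα hε hεα ha hb

lemma exists_isCore_energy_le (hα : 0 < α) (hα' : α ≤ 1) :
    ∃ φ : Config 2 → ℂ, IsCore φ ∧
      ∑ j, ∫ x in power 2 unitSquare, momentumDensity α j φ x ≤ 4 * π * α * 4 ^ α + α ^ 2 ∧
      α ^ α * (1 - π * α) ≤ ∫ x in power 2 unitSquare, ‖φ x‖ ^ 2 := by
  obtain ⟨M, hM⟩ := exists_abs_deriv_smoothTransition_le
  have hM0 : 0 ≤ M := (abs_nonneg _).trans (hM 0)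
  set C := 1 + 6 * π * (8 * M + 16 * M ^ 2)
  have hC : 0 < C := by positivity
  set ε := min (α / 2) ((α ^ 2 / C) ^ α⁻¹)
  have hε : 0 < ε := by positivity
  have herror : 6 * π * (8 * M + 16 * M ^ 2) * ε ^ α ≤ α ^ 2 := by
    calc 6 * π * (8 * M + 16 * M ^ 2) * ε ^ α
        ≤ C * ((α ^ 2 / C) ^ α⁻¹) ^ α := by
          gcongr
          · exact le_add_of_nonneg_left zero_le_one
          · exact min_le_right _ _
      _ = α ^ 2 := by
          rw [Real.rpow_inv_rpow (by positivity) hα.ne']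
          field_simp
  refine ⟨_, isCore_pairTrial_profile α hε, ?_, ?_⟩
  · exact (sum_setIntegral_momentumDensity_pairTrial_profile_le hM hα hα' hε).trans (by gcongr)
  · exact le_setIntegral_sq_norm_pairTrial_profile hα hε
      (by linarith [min_le_left (α / 2) ((α ^ 2 / C) ^ α⁻¹)])

end Trial

/-! ### Asymptotics of the ground-state energy -/

section Asymptotics

variable {x : ℝ} (hx : 0 < x)
include hx

lemma one_sub_three_mul_sq_le_rpow : 1 - 3 * x ^ 2 ≤ (x ^ 3) ^ (x ^ 3) := by
  have hlog : -(x⁻¹) ≤ Real.log x := by linarith [Real.one_sub_inv_le_log_of_pos hx]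
  calc 1 - 3 * x ^ 2 = 3 * -(x⁻¹) * x ^ 3 + 1 := by field_simp; ring
    _ ≤ 3 * Real.log x * x ^ 3 + 1 := by gcongr
    _ = Real.log (x ^ 3) * x ^ 3 + 1 := by rw [Real.log_pow]; norm_num
    _ ≤ (x ^ 3) ^ (x ^ 3) := by
        rw [Real.rpow_def_of_pos (by positivity)]
        exact Real.add_one_le_exp _

variable (hx' : x ≤ 1 / 5)
include hx'

lemma one_sub_le_rpow_mul_one_sub : 1 - x ≤ (x ^ 3) ^ (x ^ 3) * (1 - π * x ^ 3) := by
  have hpi : π * x ^ 3 ≤ 4 * x ^ 3 := by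
    gcongr
    exact Real.pi_lt_four.le
  have hx2 : 3 * x ^ 2 ≤ 1 := by nlinarith
  have hx3 : 4 * x ^ 3 ≤ 1 := by nlinarith
  calc 1 - x ≤ (1 - 3 * x ^ 2) * (1 - 4 * x ^ 3) := by nlinarith [pow_pos hx 5]
    _ ≤ (x ^ 3) ^ (x ^ 3) * (1 - π * x ^ 3) := by
        gcongr
        exact one_sub_three_mul_sq_le_rpow hx

lemma neumannEnergy_two_le : neumannEnergy 2 (x ^ 3) ≤ 4 * π * x ^ 3 * (1 + 3 * x) := by
  have hα : 0 < x ^ 3 := by positivity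
  have hα' : x ^ 3 ≤ 1 := pow_le_one₀ hx.le (by linarith)
  obtain ⟨φ, hφ, henergy, hnorm⟩ := exists_isCore_energy_le hα hα'
  have hnorm' := (one_sub_le_rpow_mul_one_sub hx hx').trans hnorm
  have hpos : 0 < ∫ x in power 2 unitSquare, ‖φ x‖ ^ 2 := by linarith
  refine (hφ.neumannEnergyOn_le (x ^ 3) hpos).trans ((div_le_iff₀ hpos).2 ?_)
  have hfour : (4 : ℝ) ^ (x ^ 3) ≤ 1 + 3 * x ^ 3 := by
    have hbernoulli := rpow_one_add_le_one_add_mul_self (s := 3) (by norm_num) hα.le hα'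
    norm_num at hbernoulli
    linarith
  have hsq : (x ^ 3) ^ 2 ≤ 4 * π * x ^ 3 * x ^ 3 := by
    nlinarith [Real.pi_gt_three, mul_pos hα hα]
  calc ∑ j, ∫ y in power 2 unitSquare, momentumDensity (x ^ 3) j φ y
      ≤ 4 * π * x ^ 3 * 4 ^ (x ^ 3) + (x ^ 3) ^ 2 := henergy
    _ ≤ 4 * π * x ^ 3 * (1 + 3 * x ^ 3) + 4 * π * x ^ 3 * x ^ 3 := by gcongr
    _ = 4 * π * x ^ 3 * (1 + 4 * x ^ 3) := by ring
    _ ≤ 4 * π * x ^ 3 * ((1 + 3 * x) * (1 - x)) := by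
        gcongr
        nlinarith
    _ = 4 * π * x ^ 3 * (1 + 3 * x) * (1 - x) := by ring
    _ ≤ 4 * π * x ^ 3 * (1 + 3 * x) * ∫ x in power 2 unitSquare, ‖φ x‖ ^ 2 := by gcongr

lemma one_sub_mul_le_sq :
    (1 - 22 * x) * ((1 + x) ^ 2 * (1 + 8 * x) + 4 * π * x ^ 2 * (1 + x)) ≤ (1 - 2 * x) ^ 2 := by
  rcases le_total (22 * x) 1 with h | h
  · have hpi : 4 * π * x ^ 2 * (1 + x) ≤ 4 * 4 * x ^ 2 * (1 + x) := by
      gcongr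
      exact Real.pi_lt_four.le
    have hx2 : x ^ 2 ≤ x / 5 := by nlinarith
    calc (1 - 22 * x) * ((1 + x) ^ 2 * (1 + 8 * x) + 4 * π * x ^ 2 * (1 + x))
        ≤ (1 - 22 * x) * (1 + 18 * x) :=
          mul_le_mul_of_nonneg_left (by nlinarith) (sub_nonneg.2 h)
      _ ≤ (1 - 2 * x) ^ 2 := by nlinarith
  · exact (mul_nonpos_of_nonpos_of_nonneg (sub_nonpos.2 h) (by positivity)).trans (sq_nonneg _)

lemma le_neumannEnergy_two : 4 * π * x ^ 3 * (1 - 22 * x) ≤ neumannEnergy 2 (x ^ 3) := by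
  have hα : 0 < x ^ 3 := by positivity
  have hx3 : x ^ 3 ≤ x / 25 := by nlinarith [mul_pos hx hx]
  have hα' : 4 * π * x ^ 3 ≤ 1 := by nlinarith [Real.pi_lt_four, Real.pi_pos]
  obtain ⟨φ, hφ, -, hnorm⟩ := exists_isCore_energy_le hα (by linarith)
  refine le_neumannEnergyOn hφ (by linarith [one_sub_le_rpow_mul_one_sub hx hx']) fun φ hφ => ?_
  have hN : 0 ≤ ∫ x in power 2 unitSquare, ‖φ x‖ ^ 2 := integral_nonneg fun _ => by positivity
  set N := ∫ x in power 2 unitSquare, ‖φ x‖ ^ 2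
  set L := (1 + x) * ((1 + x) / (2 * π * x ^ 3) + 4 * (1 + x⁻¹) / (π * x)) + 2 * (1 + x⁻¹)
    with hL
  have hLeq : 4 * π * x ^ 3 * L
      = 2 * ((1 + x) ^ 2 * (1 + 8 * x) + 4 * π * x ^ 2 * (1 + x)) := by
    rw [hL]
    field
  have hLpos : 0 < L := by positivity
  refine le_of_mul_le_mul_left ?_ hLpos
  calc L * (4 * π * x ^ 3 * (1 - 22 * x) * N)
      = 2 * ((1 - 22 * x) * ((1 + x) ^ 2 * (1 + 8 * x) + 4 * π * x ^ 2 * (1 + x)) * N) := by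
        linear_combination (1 - 22 * x) * N * hLeq
    _ ≤ 2 * ((1 - 2 * x) ^ 2 * N) := by
        gcongr
        exact one_sub_mul_le_sq hx hx'
    _ ≤ L * ∑ j, ∫ y in power 2 unitSquare, momentumDensity (x ^ 3) j φ y :=
        hφ.mul_setIntegral_sq_norm_le hα hα' hx (by linarith) hx

end Asymptotics

lemma abs_neumannEnergy_two_div_sub_one_le {α : ℝ} (hα : 0 < α) (hα' : α ≤ 1 / 125) :
    |neumannEnergy 2 α / (4 * π * α) - 1| ≤ 22 * α ^ (1 / 3 : ℝ) := by
  obtain ⟨x, hx, rfl⟩ : ∃ x : ℝ, 0 < x ∧ x ^ 3 = α :=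
    ⟨α ^ (3⁻¹ : ℝ), by positivity, Real.rpow_inv_natCast_pow hα.le three_ne_zero⟩
  have hx' : x ≤ 1 / 5 := le_of_pow_le_pow_left₀ three_ne_zero (by norm_num) (by linarith)
  have hroot : (x ^ 3) ^ (1 / 3 : ℝ) = x := by
    rw [one_div]
    exact Real.pow_rpow_inv_natCast hx.le three_ne_zero
  have hpos : 0 < 4 * π * x ^ 3 := by positivity
  rw [hroot, abs_sub_le_iff, sub_le_iff_le_add, sub_le_comm, div_le_iff₀' hpos, le_div_iff₀' hpos]
  refine ⟨(neumannEnergy_two_le hx hx').trans ?_, le_neumannEnergy_two hx hx'⟩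
  gcongr ?_ * ?_
  linarith

end Anyon

theorem mainTheorem4 :
    ∃ g : ℝ → ℝ,
      g =O[𝓝[>] (0 : ℝ)] (fun α : ℝ => α ^ (1 / 3 : ℝ)) ∧
      ∀ᶠ α in 𝓝[>] (0 : ℝ),
        Anyon.neumannEnergy 2 α = 4 * Real.pi * α * (1 + g α) := by
  refine ⟨fun α => Anyon.neumannEnergy 2 α / (4 * Real.pi * α) - 1, .of_bound 22 ?_, ?_⟩
  · filter_upwards [Ioo_mem_nhdsGT (show (0 : ℝ) < 1 / 125 by norm_num)] with α hα
    rw [Real.norm_eq_abs, Real.norm_of_nonneg (Real.rpow_nonneg hα.1.le _)]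
    exact Anyon.abs_neumannEnergy_two_div_sub_one_le hα.1 hα.2.le
  · filter_upwards [self_mem_nhdsWithin] with α (hα : 0 < α)
    field_simp
    ring
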